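/- **Conventions.** A Fréchet space $(F,d)$ is a real locally convex topological vector space whose topology is given by a complete translation-invariant metric $d$ with absolutely convex balls; finite products carry the maximum metric and $\mathbb R$ its usual metric. For Fréchet spaces $(E,g)$, $(F,d)$ let $\mathcal L_{g,d}(E,F)$ be the space of linear maps $L:E\to F$ with $\mathrm{Lip}(L)=\sup_{x\neq 0} d(Lx,0)/g(x,0)<\infty$, with the metric $\mathrm{Lip}(L-H)$, let $\mathcal L_{g,d}(E,F)_0$ be the connected component of $0$, and put $\mathcal L_d(F)=\mathcal L_{d,d}(F,F)$. Let $U\subseteq E$ be open. A map $P:U\to F$ is $MC^0$ if it is continuous. It is $MC^{k+1}$ if it is continuous, all directional derivatives $P'(p)h=\lim_{t\to0}(P(p+th)-P(p))/t$ exist, $P'(p)\in\mathcal L_{g,d}(E,F)$ for every $p\in U$, $(p,h)\mapsto P'(p)h$ is continuous, $P':U\to\mathcal L_{g,d}(E,F)$ is continuous, and every $x_0\in U$ has a connected open neighbourhood $V\subseteq U$ such that $P'|_V-P'(x_0):V\to\mathcal L_{g,d}(E,F)_0$ is $MC^k$. It is $MC^\infty$ (smooth) if it is $MC^k$ for all $k\ge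 0$. A map from an open set into $\mathcal L_{g,d}(E,F)$ is smooth if it is continuous and, near every point $x_0$, its difference with its value at $x_0$ is an $MC^\infty$ map into $\mathcal L_{g,d}(E,F)_0$. A *bounded Fréchet manifold* modelled on $(F,d)$ is a Hausdorff second countable space with an atlas of charts with values in $F$ whose transition maps are $MC^\infty$. Its tangent bundle $TM$ has fibre $F$ and is glued from the sets $\varphi(U)\times F$, for charts $(U,\varphi)$ of the atlas, by the tangent maps of the transition maps; $T(TM)$ is obtained in the same way. A *(linear) connection* on $M$ is a smooth bundle morphism $\mathcal K:T(TM)\to TM$ whose local form in each chart is $(f,g,h,k)\mapsto(f,\,k+\tau(f,g)h)$ with $\tau:\varphi(U)\times F\to\mathcal L_d(F)$ smooth and linear in $g$. The covariant derivative of a smooth vector field $\xi:M\to TM$ is $\nabla\xi(p)=\mathcal K\circ T_p\xi:T_pM\to T_pM$; the field $\xi$ is *Lipschitz-Fredholm* with respect to $\mathcal K$ if for every $p$ the operator $\nabla\xi(p)$ is linear with finite Lipschitz constant (with respect to $d$, in the chart identification $T_pM\cong F$), has closed image, finite-dimensional kernel and image of finite codimension. A *Finsler structure* on $M$ is a sequence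 of functions $\|\cdot\|^n:TM\to[0,\infty)$, $n\in\mathbb N$, such that in the trivialization of $TM$ given by each chart of the atlas: (i) for every fixed base point $b$ the functions $\|\cdot\|^n_b$ are seminorms on $F$ that define its topology; (ii) for all $K>1$ and every base point $x_0$ there is a neighbourhood of $x_0$ such that $\frac1K\|f\|^n_{x_0}\le\|f\|^n_x\le K\|f\|^n_{x_0}$ for all $x$ in it, all $n$ and all $f\in F$. For $x,y\in M$ let $\rho^n(x,y)\in[0,\infty]$ be the infimum of $\int_a^b\max_{i\le n}\|\gamma'(t)\|^i\,dt$ over all continuous piecewise $MC^1$ curves $\gamma:[a,b]\to M$ from $x$ to $y$, and let $\rho=\sum_{n\ge1}2^{-n}\frac{\rho^n}{1+\rho^n}$ (with $\frac{\infty}{1+\infty}=1$). A set $B\subseteq M$ is *bounded* if $\sup_{a,b\in B}\rho(a,b)<\infty$. The field $\xi$ satisfies condition *(WCV)* if the set of its zeros in every closed bounded subset of $M$ is compact. An $MC^\infty$ functional $l:M\to\mathbb R$ is *associated* to $\xi$ if for every $p\in M$: $Dl(p)=0$ if and only if $\xi(p)=0$. Put $\mathrm{Crit}_l=\{p\in M: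 Dl(p)=0\}$; the critical values are the elements of $l(\mathrm{Crit}_l)$, and all other real numbers are regular values. **Theorem (Morse–Sard–Brown).** Let $M$ be a connected bounded Fréchet manifold with a Finsler structure and with a (linear) connection $\mathcal K$, and let $\xi$ be a smooth vector field on $M$ that is Lipschitz-Fredholm with respect to $\mathcal K$ and satisfies condition (WCV). Then for every $MC^\infty$ functional $l:M\to\mathbb R$ associated to $\xi$, the set of critical values $l(\mathrm{Crit}_l)$ is of first category in $\mathbb R$. Hence the set of regular values of $l$ is a residual subset of $\mathbb R$. -/

import Mathlib

open Set Filter Topology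
open scoped ENNReal Manifold

namespace BoundedFrechet

noncomputable section

universe u v

/-! ### Fréchet spaces with a standard metric -/

/-- The metric is translation invariant and its balls are absolutely convex. -/
class StandardMetric (F : Type u) [AddCommGroup F] [Module ℝ F] [MetricSpace F] : Prop where
  dist_add_right' : ∀ x y z : F, dist (x + z) (y + z) = dist x y
  absConvex_ball : ∀ r : ℝ, AbsConvex ℝ (Metric.ball (0 : F) r)

/-- A (real) Fréchet space `(F, d)`: a complete locally convex topological vector space whose
topology is given by the complete translation-invariant metric `d = dist` with absolutely convex
balls. -/
class FrechetSpace (F : Type u) [AddCommGroup F] [Module ℝ F] [MetricSpace F] : Prop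
    extends StandardMetric F, IsTopologicalAddGroup F, ContinuousSMul ℝ F,
      LocallyConvexSpace ℝ F, CompleteSpace F

section Metric

variable {F : Type u} [AddCommGroup F] [Module ℝ F] [MetricSpace F] [StandardMetric F]

theorem dist_sub_zero (x y : F) : dist (x - y) 0 = dist x y := by
  have h := StandardMetric.dist_add_right' (x - y) 0 y
  simpa using h.symm

theorem dist_neg_zero (x : F) : dist (-x) 0 = dist x 0 := by
  have h := dist_sub_zero 0 x
  rw [zero_sub] at h
  rw [h, dist_comm]

theorem dist_add_zero_le (x y : F) : dist (x + y) 0 ≤ dist x 0 + dist y 0 := by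
  have h1 := dist_triangle (x + y) y 0
  have h2 := StandardMetric.dist_add_right' x 0 y
  rw [zero_add] at h2
  linarith

theorem dist_smul_zero_le {a : ℝ} (ha : |a| ≤ 1) (x : F) : dist (a • x) 0 ≤ dist x 0 := by
  refine le_of_forall_pos_lt_add fun ε hε => ?_
  have hx : x ∈ Metric.ball (0 : F) (dist x 0 + ε) := by simp [hε]
  exact (StandardMetric.absConvex_ball (F := F) (dist x 0 + ε)).1 a ha (smul_mem_smul_set hx)

theorem dist_convex_zero_le {a b : ℝ} (ha : 0 ≤ a) (hb : 0 ≤ b) (hab : a + b = 1) (x y : F) :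
    dist (a • x + b • y) 0 ≤ max (dist x 0) (dist y 0) := by
  refine le_of_forall_pos_lt_add fun ε hε => ?_
  have hx : x ∈ Metric.ball (0 : F) (max (dist x 0) (dist y 0) + ε) :=
    lt_of_le_of_lt (le_max_left _ _) (lt_add_of_pos_right _ hε)
  have hy : y ∈ Metric.ball (0 : F) (max (dist x 0) (dist y 0) + ε) :=
    lt_of_le_of_lt (le_max_right _ _) (lt_add_of_pos_right _ hε)
  exact (StandardMetric.absConvex_ball (F := F) _).2 hx hy ha hb hab

theorem dist_nsmul_zero_le (n : ℕ) (x : F) : dist ((n : ℝ) • x) 0 ≤ n * dist x 0 := by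
  induction n with
  | zero => simp
  | succ n ih =>
    have h := dist_add_zero_le ((n : ℝ) • x) x
    push_cast
    rw [add_smul, one_smul]
    linarith

theorem dist_smul_zero_le_ceil (c : ℝ) (x : F) :
    dist (c • x) 0 ≤ (⌈|c|⌉₊ + 1 : ℕ) * dist x 0 := by
  have hpos : (0 : ℝ) < (⌈|c|⌉₊ + 1 : ℕ) := by positivity
  have hc : |c| ≤ (⌈|c|⌉₊ + 1 : ℕ) := by
    push_cast
    linarith [Nat.le_ceil |c|]
  have h1 : |c / (⌈|c|⌉₊ + 1 : ℕ)| ≤ 1 := by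
    rw [abs_div, abs_of_pos hpos, div_le_one hpos]
    exact hc
  have h2 : c • x = (c / (⌈|c|⌉₊ + 1 : ℕ)) • (((⌈|c|⌉₊ + 1 : ℕ) : ℝ) • x) := by
    rw [smul_smul, div_mul_cancel₀ _ hpos.ne']
  rw [h2]
  exact (dist_smul_zero_le h1 _).trans (dist_nsmul_zero_le _ _)

end Metric

/-- A criterion for a metric to be standard. -/
theorem StandardMetric.of_le {F : Type u} [AddCommGroup F] [Module ℝ F] [MetricSpace F]
    (h1 : ∀ x y z : F, dist (x + z) (y + z) = dist x y)
    (h2 : ∀ (a : ℝ) (x : F), |a| ≤ 1 → dist (a • x) 0 ≤ dist x 0)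
    (h3 : ∀ (a b : ℝ) (x y : F), 0 ≤ a → 0 ≤ b → a + b = 1 →
      dist (a • x + b • y) 0 ≤ max (dist x 0) (dist y 0)) : StandardMetric F := by
  refine ⟨h1, fun r => ⟨?_, ?_⟩⟩
  · rintro a ha _ ⟨x, hx, rfl⟩
    exact lt_of_le_of_lt (h2 a x ha) hx
  · intro x hx y hy a b ha hb hab
    exact lt_of_le_of_lt (h3 a b x y ha hb hab) (max_lt hx hy)

instance : StandardMetric ℝ := by
  refine StandardMetric.of_le (fun x y z => by simp) (fun a x ha => ?_) ?_
  · simp only [smul_eq_mul, dist_zero_right, norm_mul, Real.norm_eq_abs]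
    exact mul_le_of_le_one_left (abs_nonneg x) ha
  · intro a b x y ha hb hab
    simp only [smul_eq_mul, dist_zero_right, Real.norm_eq_abs]
    have h1 := le_max_left |x| |y|
    have h2 := le_max_right |x| |y|
    calc |a * x + b * y| ≤ |a * x| + |b * y| := abs_add_le _ _
      _ = a * |x| + b * |y| := by rw [abs_mul, abs_mul, abs_of_nonneg ha, abs_of_nonneg hb]
      _ ≤ a * max |x| |y| + b * max |x| |y| := by gcongr
      _ = max |x| |y| := by rw [← add_mul, hab, one_mul]

instance instStandardMetricULift {F : Type v} [AddCommGroup F] [Module ℝ F] [MetricSpace F]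
    [StandardMetric F] : StandardMetric (ULift.{u} F) :=
  StandardMetric.of_le
    (fun x y z => StandardMetric.dist_add_right' x.down y.down z.down)
    (fun _ x ha => dist_smul_zero_le ha x.down)
    (fun _ _ x y ha hb hab => dist_convex_zero_le ha hb hab x.down y.down)

/-- A finite product carries the maximum metric. -/
instance instStandardMetricProd {E : Type u} {F : Type v}
    [AddCommGroup E] [Module ℝ E] [MetricSpace E] [StandardMetric E]
    [AddCommGroup F] [Module ℝ F] [MetricSpace F] [StandardMetric F] :
    StandardMetric (E × F) := by
  refine StandardMetric.of_le (fun x y z => ?_) (fun a x ha => ?_) ?_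
  · simp only [Prod.dist_eq, Prod.fst_add, Prod.snd_add, StandardMetric.dist_add_right']
  · simp only [Prod.dist_eq, Prod.smul_fst, Prod.smul_snd, Prod.fst_zero, Prod.snd_zero]
    exact max_le_max (dist_smul_zero_le ha _) (dist_smul_zero_le ha _)
  · intro a b x y ha hb hab
    simp only [Prod.dist_eq, Prod.smul_fst, Prod.smul_snd, Prod.fst_zero, Prod.snd_zero,
      Prod.fst_add, Prod.snd_add]
    have h1 := dist_convex_zero_le ha hb hab x.1 y.1
    have h2 := dist_convex_zero_le ha hb hab x.2 y.2
    refine max_le (h1.trans ?_) (h2.trans ?_)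
    · exact max_le_max (le_max_left _ _) (le_max_left _ _)
    · exact max_le_max (le_max_right _ _) (le_max_right _ _)

/-! ### Globally Lipschitz linear maps -/

section Lip

variable (E : Type u) (F : Type v)
  [AddCommGroup E] [Module ℝ E] [MetricSpace E]
  [AddCommGroup F] [Module ℝ F] [MetricSpace F] [StandardMetric F]

/-- The linear maps `L` with `d (L x, 0) ≤ C * g (x, 0)` for some constant `C`. -/
def lipSubmodule : Submodule ℝ (E →ₗ[ℝ] F) where
  carrier := {L | ∃ C : ℝ, ∀ x, dist (L x) 0 ≤ C * dist x 0}
  zero_mem' := ⟨0, fun x => by simp⟩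
  add_mem' := by
    rintro L H ⟨C, hC⟩ ⟨D, hD⟩
    refine ⟨C + D, fun x => ?_⟩
    have h := dist_add_zero_le (L x) (H x)
    rw [LinearMap.add_apply, add_mul]
    linarith [hC x, hD x]
  smul_mem' := by
    rintro c L ⟨C, hC⟩
    refine ⟨(⌈|c|⌉₊ + 1 : ℕ) * C, fun x => ?_⟩
    rw [LinearMap.smul_apply, mul_assoc]
    exact (dist_smul_zero_le_ceil c (L x)).trans
      (mul_le_mul_of_nonneg_left (hC x) (by positivity))

/-- The space `𝓛_{g,d}(E, F)` of linear maps with finite Lipschitz constant. -/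
def LipMap : Type (max u v) := lipSubmodule E F

instance : AddCommGroup (LipMap E F) := inferInstanceAs (AddCommGroup (lipSubmodule E F))

instance : Module ℝ (LipMap E F) := inferInstanceAs (Module ℝ (lipSubmodule E F))

variable {E F}

/-- The underlying linear map. -/
def LipMap.toLin (L : LipMap E F) : E →ₗ[ℝ] F := Subtype.val L

instance : CoeFun (LipMap E F) (fun _ => E → F) := ⟨fun L => L.toLin⟩

/-- `Lip(L) = sup_{x ≠ 0} d (L x, 0) / g (x, 0)` (the term with `x = 0` is `0 / 0 = 0`). -/
def LipMap.lip (L : LipMap E F) : ℝ := ⨆ x : E, dist (L x) 0 / dist x 0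

theorem LipMap.ext_apply {L H : LipMap E F} (h : ∀ x, L x = H x) : L = H :=
  Subtype.ext (LinearMap.ext h)

theorem LipMap.bddAbove (L : LipMap E F) :
    BddAbove (range fun x : E => dist (L x) 0 / dist x 0) := by
  obtain ⟨C, hC⟩ := L.2
  refine ⟨|C|, ?_⟩
  rintro _ ⟨x, rfl⟩
  refine div_le_of_le_mul₀ dist_nonneg (abs_nonneg C) ((hC x).trans ?_)
  exact mul_le_mul_of_nonneg_right (le_abs_self C) dist_nonneg

theorem LipMap.lip_nonneg (L : LipMap E F) : 0 ≤ L.lip :=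
  Real.iSup_nonneg fun _ => by positivity

theorem LipMap.le_lip (L : LipMap E F) (x : E) : dist (L x) 0 ≤ L.lip * dist x 0 := by
  rcases eq_or_ne x 0 with rfl | hx
  · simp
  · rw [← div_le_iff₀ (dist_pos.2 hx)]
    exact le_ciSup L.bddAbove x

theorem LipMap.lip_le {L : LipMap E F} {C : ℝ} (hC : 0 ≤ C)
    (h : ∀ x, dist (L x) 0 ≤ C * dist x 0) : L.lip ≤ C :=
  ciSup_le fun x => div_le_of_le_mul₀ dist_nonneg hC (h x)

/-- The metric `D(L, H) = Lip(L - H)`. -/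
instance : MetricSpace (LipMap E F) where
  dist L H := (L - H).lip
  dist_self L := by
    refine le_antisymm (LipMap.lip_le le_rfl fun x => ?_) (LipMap.lip_nonneg _)
    rw [sub_self]
    exact (dist_self (0 : F)).le.trans (by simp)
  dist_comm L H := by
    have key : ∀ L H : LipMap E F, (L - H).lip ≤ (H - L).lip := fun L H => by
      refine LipMap.lip_le (LipMap.lip_nonneg _) fun x => ?_
      have h : (L - H) x = -((H - L) x) := (neg_sub (H x) (L x)).symm
      rw [h, dist_neg_zero]
      exact LipMap.le_lip _ x
    exact le_antisymm (key L H) (key H L)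
  dist_triangle L H K := by
    refine LipMap.lip_le (add_nonneg (LipMap.lip_nonneg _) (LipMap.lip_nonneg _)) fun x => ?_
    have h : (L - K) x = (L - H) x + (H - K) x := (sub_add_sub_cancel (L x) (H x) (K x)).symm
    rw [h, add_mul]
    exact (dist_add_zero_le _ _).trans (add_le_add (LipMap.le_lip _ x) (LipMap.le_lip _ x))
  eq_of_dist_eq_zero := by
    intro L H h
    refine LipMap.ext_apply fun x => ?_
    have h1 := LipMap.le_lip (L - H) x
    have h2 : (L - H).lip = 0 := h
    rw [h2, zero_mul] at h1
    exact sub_eq_zero.1 (dist_le_zero.1 h1)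

theorem LipMap.dist_eq (L H : LipMap E F) : dist L H = (L - H).lip := rfl

theorem LipMap.dist_zero (L : LipMap E F) : dist L 0 = L.lip := by
  rw [LipMap.dist_eq, sub_zero]

instance : StandardMetric (LipMap E F) := by
  refine StandardMetric.of_le (fun x y z => ?_) (fun a L ha => ?_) ?_
  · rw [LipMap.dist_eq, LipMap.dist_eq, add_sub_add_right_eq_sub]
  · rw [LipMap.dist_zero, LipMap.dist_zero]
    exact LipMap.lip_le (LipMap.lip_nonneg _) fun x =>
      (dist_smul_zero_le ha (L x)).trans (LipMap.le_lip L x)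
  · intro a b L H ha hb hab
    rw [LipMap.dist_zero, LipMap.dist_zero, LipMap.dist_zero]
    refine LipMap.lip_le (le_max_of_le_left (LipMap.lip_nonneg _)) fun x => ?_
    refine (dist_convex_zero_le ha hb hab (L x) (H x)).trans (max_le ?_ ?_)
    · exact (LipMap.le_lip L x).trans
        (mul_le_mul_of_nonneg_right (le_max_left _ _) dist_nonneg)
    · exact (LipMap.le_lip H x).trans
        (mul_le_mul_of_nonneg_right (le_max_right _ _) dist_nonneg)

theorem continuous_const_smul_of_standard {G : Type v} [AddCommGroup G] [Module ℝ G]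
    [MetricSpace G] [StandardMetric G] (c : ℝ) : Continuous fun x : G => c • x := by
  refine (LipschitzWith.of_dist_le_mul (K := (⌈|c|⌉₊ + 1 : ℕ)) fun x y => ?_).continuous
  rw [← dist_sub_zero, ← smul_sub, ← dist_sub_zero x y]
  exact dist_smul_zero_le_ceil c (x - y)

theorem continuous_add_left_of_standard {G : Type v} [AddCommGroup G] [Module ℝ G]
    [MetricSpace G] [StandardMetric G] (a : G) : Continuous fun x : G => a + x := by
  refine (Isometry.of_dist_eq fun x y => ?_).continuous
  rw [add_comm a x, add_comm a y]
  exact StandardMetric.dist_add_right' x y a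

variable (E F)

/-- The connected component `𝓛_{g,d}(E, F)₀` of the zero map; it is a linear subspace. -/
def lipZeroComponent : Submodule ℝ (LipMap E F) where
  carrier := connectedComponent 0
  zero_mem' := mem_connectedComponent
  add_mem' := by
    intro a b ha hb
    have h1 := (continuous_add_left_of_standard a).mapsTo_connectedComponent 0 hb
    simp only [add_zero] at h1
    rwa [connectedComponent_eq ha]
  smul_mem' := by
    intro c a ha
    have h1 := (continuous_const_smul_of_standard (G := LipMap E F) c).mapsTo_connectedComponent
      0 ha
    simpa using h1

/-- The space `𝓛_{g,d}(E, F)₀` with the metric induced from `𝓛_{g,d}(E, F)`. -/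
def LipMapZero : Type (max u v) := lipZeroComponent E F

instance : AddCommGroup (LipMapZero E F) := inferInstanceAs (AddCommGroup (lipZeroComponent E F))

instance : Module ℝ (LipMapZero E F) := inferInstanceAs (Module ℝ (lipZeroComponent E F))

instance : MetricSpace (LipMapZero E F) := inferInstanceAs (MetricSpace (lipZeroComponent E F))

instance : StandardMetric (LipMapZero E F) :=
  StandardMetric.of_le
    (fun x y z => StandardMetric.dist_add_right' x.1 y.1 z.1)
    (fun _ x ha => dist_smul_zero_le ha x.1)
    (fun _ _ x y ha hb hab => dist_convex_zero_le ha hb hab x.1 y.1)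

variable {E F}

/-- The inclusion of the zero component in the space of all Lipschitz linear maps. -/
def LipMapZero.toLipMap (L : LipMapZero E F) : LipMap E F := Subtype.val L

/-- A Lipschitz-Fredholm operator: a linear map with finite Lipschitz constant, closed image,
finite-dimensional kernel, and image of finite codimension. -/
structure IsLipschitzFredholm (L : LipMap E F) : Prop where
  isClosed_range : IsClosed (LinearMap.range L.toLin : Set F)
  finite_ker : FiniteDimensional ℝ (LinearMap.ker L.toLin)
  finite_coker : FiniteDimensional ℝ (F ⧸ LinearMap.range L.toLin)

end Lip

/-! ### Maps of class `MC^k` -/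

section MC

/-- The directional derivative `lim_{t → 0} (P (x + t h) - P x) / t`. -/
def dirDeriv {E : Type u} {F : Type v} [AddCommGroup E] [Module ℝ E]
    [AddCommGroup F] [Module ℝ F] [MetricSpace F] (P : E → F) (x h : E) : F :=
  limUnder (𝓝[≠] (0 : ℝ)) fun t => t⁻¹ • (P (x + t • h) - P x)

variable {E : Type u} [AddCommGroup E] [Module ℝ E] [MetricSpace E]

/-- `P` is b-differentiable on the open set `U`, with derivative `P'`: it is continuous and
Keller-differentiable, its derivatives are globally Lipschitz linear maps, and `P'` is continuous
as a map to `𝓛_{g,d}(E, F)`. (Joint continuity of `(p, h) ↦ P' p h` implies that of `P'` for the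
compact-open topology.) -/
structure HasBDerivOn {F : Type v} [AddCommGroup F] [Module ℝ F] [MetricSpace F]
    [StandardMetric F] (P : E → F) (P' : E → LipMap E F) (U : Set E) : Prop where
  continuousOn : ContinuousOn P U
  tendsto : ∀ p ∈ U, ∀ h : E,
    Tendsto (fun t : ℝ => t⁻¹ • (P (p + t • h) - P p)) (𝓝[≠] 0) (𝓝 (P' p h))
  continuousOn_apply : ContinuousOn (fun q : E × E => P' q.1 q.2) (U ×ˢ univ)
  continuousOn_deriv : ContinuousOn P' U

/-- Every point `x₀` of `U` has a connected open neighbourhood `V ⊆ U` on which `T - T x₀` takes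
values in the zero component `𝓛_{g,d}(E, F)₀` and, as a map to that space, has the
property `R`. -/
def LocallyInZeroComponent {X : Type u} [TopologicalSpace X]
    {E F : Type*} [AddCommGroup E] [Module ℝ E] [MetricSpace E]
    [AddCommGroup F] [Module ℝ F] [MetricSpace F] [StandardMetric F]
    (R : Set X → (X → LipMapZero E F) → Prop) (U : Set X) (T : X → LipMap E F) : Prop :=
  ∀ x₀ ∈ U, ∃ V : Set X, IsOpen V ∧ IsConnected V ∧ x₀ ∈ V ∧ V ⊆ U ∧
    ∃ Q : X → LipMapZero E F, (∀ x ∈ V, (Q x).toLipMap = T x - T x₀) ∧ R V Q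

/-- `P` is of class `MC^k` on the open set `U`. The universe of the target is at least that of
the source, so that the definition can be applied to the derivative. -/
def MC : ℕ → ∀ {F : Type (max u v)} [AddCommGroup F] [Module ℝ F] [MetricSpace F]
    [StandardMetric F], Set E → (E → F) → Prop
  | 0, _, _, _, _, _, U, P => ContinuousOn P U
  | k + 1, F, _, _, _, _, U, P => ∃ P' : E → LipMap E F, HasBDerivOn P P' U ∧
      LocallyInZeroComponent (fun V Q => MC k (F := LipMapZero E F) V Q) U P'

/-- `P` is of class `MC^∞` on the open set `U`. -/
def MCInfty {F : Type (max u v)} [AddCommGroup F] [Module ℝ F] [MetricSpace F]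
    [StandardMetric F] (U : Set E) (P : E → F) : Prop :=
  ∀ k : ℕ, MC.{u, v} k U P

/-- A real-valued function of class `MC^∞`; `ℝ` carries its usual metric. -/
def MCInftyReal (U : Set E) (f : E → ℝ) : Prop :=
  MCInfty.{u, u} U fun x => ULift.up.{u} (f x)

/-- A map of class `MC^∞` to the locally convex vector group `𝓛_{g,d}(G, F)`: it is continuous
and locally, up to a constant, an `MC^∞` map to the zero component. -/
def MCInftyLip {G F : Type u} [AddCommGroup G] [Module ℝ G] [MetricSpace G]
    [AddCommGroup F] [Module ℝ F] [MetricSpace F] [StandardMetric F]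
    (U : Set E) (T : E → LipMap G F) : Prop :=
  ContinuousOn T U ∧ LocallyInZeroComponent (MCInfty.{u, u} (E := E)) U T

end MC

/-! ### Bounded Fréchet manifolds and their tangent bundles -/

section Manifold

variable (F : Type u) [AddCommGroup F] [Module ℝ F] [MetricSpace F] [FrechetSpace F]
  (M : Type v) [TopologicalSpace M] [ChartedSpace F M]

/-- A bounded Fréchet manifold modelled on `(F, d)`: Hausdorff, second countable, with an atlas
of charts with values in `F` whose coordinate transition functions are `MC^∞`. -/
class BoundedFrechetManifold : Prop extends T2Space M, SecondCountableTopology M where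
  transition : ∀ e ∈ atlas F M, ∀ e' ∈ atlas F M,
    MCInfty.{u, u} (e.symm.trans e').source (e' ∘ e.symm)

/-- The tangent map `(x, h) ↦ (P x, D P(x) h)` of a map between open subsets of vector spaces. -/
def tangentMap {E : Type*} {G : Type*} [AddCommGroup E] [Module ℝ E]
    [AddCommGroup G] [Module ℝ G] [MetricSpace G] (P : E → G) (q : E × E) : G × G :=
  (P q.1, dirDeriv P q.1 q.2)

/-- The tangent bundle `TM`. A tangent vector at `base` is recorded by its coordinate vector
`vec` in the preferred chart `chartAt F base` at its base point. -/
structure Tan where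
  base : M
  vec : F

/-- The second tangent bundle `T(TM)`. A tangent vector of `TM` at `base` is recorded by its
coordinate vector in the chart of `TM` induced by `chartAt F base.base`. -/
structure TanTan where
  base : Tan F M
  vec : F × F

variable {F M}

/-- The coordinates `(x, h)` of a tangent vector in the bundle chart of `TM` induced by the chart
`e` (for tangent vectors with base point in `e.source`). -/
def Tan.coord (e : OpenPartialHomeomorph M F) (w : Tan F M) : F × F :=
  tangentMap (e ∘ (chartAt F w.base).symm) (chartAt F w.base w.base, w.vec)

/-- The tangent vector at `p ∈ e.source` whose coordinate vector in the chart `e` is `f`. -/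
def Tan.ofCoord (e : OpenPartialHomeomorph M F) (p : M) (f : F) : Tan F M :=
  ⟨p, dirDeriv (chartAt F p ∘ e.symm) (e p) f⟩

/-- The coordinates `((f, g), (h, k))` of an element of `T(TM)` in the chart induced by `e`. -/
def TanTan.coord (e : OpenPartialHomeomorph M F) (W : TanTan F M) :
    (F × F) × (F × F) :=
  tangentMap (tangentMap (e ∘ (chartAt F W.base.base).symm))
    ((chartAt F W.base.base W.base.base, W.base.vec), W.vec)

/-! ### Connections and vector fields -/

/-- The local form `(f, g, h, k) ↦ (f, k + τ (f, g) h)` of a connection map. -/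
def localForm (τ : F × F → LipMap F F) (q : (F × F) × (F × F)) : F × F :=
  (q.1.1, q.2.2 + τ q.1 q.2.1)

/-- A linear connection on `M`: a smooth bundle morphism `K : T(TM) → TM` whose local form in
each chart is `(f, g, h, k) ↦ (f, k + τ (f, g) h)` with `τ` smooth with values in `𝓛_d(F)` and
linear in the second variable. -/
structure IsLinearConnection (K : TanTan F M → Tan F M) : Prop where
  base_eq : ∀ W, (K W).base = W.base.base
  local_form : ∀ e ∈ atlas F M, ∃ τ : F × F → LipMap F F,
    MCInftyLip (e.target ×ˢ univ) τ ∧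
    MCInfty.{u, u} ((e.target ×ˢ univ) ×ˢ univ) (localForm τ) ∧
    (∀ f ∈ e.target, IsLinearMap ℝ fun g => τ (f, g)) ∧
    ∀ W : TanTan F M, W.base.base ∈ e.source → (K W).coord e = localForm τ (W.coord e)

/-- A smooth vector field, as a map `ξ : M → TM`: a section with `MC^∞` local
representatives. -/
structure IsSmoothVectorField (ξ : M → Tan F M) : Prop where
  base_eq : ∀ p, (ξ p).base = p
  smooth : ∀ e ∈ atlas F M, MCInfty.{u, u} e.target fun x => (ξ (e.symm x)).coord e

/-- The tangent map `Tξ : TM → T(TM)` of a vector field. -/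
def tangentMapField (ξ : M → Tan F M) (w : Tan F M) : TanTan F M :=
  ⟨ξ w.base, dirDeriv (fun x => (ξ ((chartAt F w.base).symm x)).coord (chartAt F w.base))
    (chartAt F w.base w.base) w.vec⟩

/-- The covariant derivative `∇ξ = K ∘ Tξ`. -/
def covDeriv (K : TanTan F M → Tan F M) (ξ : M → Tan F M) (w : Tan F M) : Tan F M :=
  K (tangentMapField ξ w)

/-- `ξ` is Lipschitz-Fredholm with respect to `K`: at each `p` the covariant derivative
`∇ξ(p) : T_p M → T_p M` is a linear Lipschitz-Fredholm operator. Here `T_p M` is identified with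
`F` through the preferred chart at `p`; other charts of the atlas change the operator by a
conjugation with a bi-Lipschitz linear isomorphism. -/
def IsLipschitzFredholmField (K : TanTan F M → Tan F M) (ξ : M → Tan F M) : Prop :=
  ∀ p : M, ∃ L : LipMap F F, (∀ y : F, covDeriv K ξ ⟨p, y⟩ = ⟨p, L y⟩) ∧ IsLipschitzFredholm L

/-! ### Finsler structures and the Finsler metric -/

/-- A Finsler structure on the trivial bundle `X × F`: `N n b f` is `‖f‖_b^n`. -/
structure IsFinslerTrivial {X : Type*} [TopologicalSpace X] (N : ℕ → X → F → ℝ) : Prop where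
  seminorms : ∀ b : X, ∃ p : SeminormFamily ℝ F ℕ, (∀ n f, p n f = N n b f) ∧ WithSeminorms p
  locally_comparable : ∀ K : ℝ, 1 < K → ∀ x₀ : X, ∃ U ∈ 𝓝 x₀, ∀ x ∈ U, ∀ (n : ℕ) (f : F),
    1 / K * N n x₀ f ≤ N n x f ∧ N n x f ≤ K * N n x₀ f

/-- A Finsler structure on `TM`: functions `‖·‖^n` on `TM` that form a Finsler structure in each
trivialization of `TM` given by a chart of the atlas. -/
def IsFinsler (N : ℕ → Tan F M → ℝ) : Prop :=
  ∀ e ∈ atlas F M, IsFinslerTrivial fun n (b : e.source) f => N n (Tan.ofCoord e (b : M) f)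

/-- The graded (increasing) Finsler structure `max_{i ≤ n} ‖·‖^i`. -/
def gradedFinsler (N : ℕ → Tan F M → ℝ) (n : ℕ) (w : Tan F M) : ℝ :=
  (Finset.range (n + 1)).sup' Finset.nonempty_range_add_one fun i => N i w

/-- A curve of class `MC^1` on the open set `O ⊆ ℝ`. -/
def IsMC1Curve (O : Set ℝ) (γ : ℝ → M) : Prop :=
  ContinuousOn γ O ∧ ∀ e ∈ atlas F M, MC.{0, u} 1 (O ∩ γ ⁻¹' e.source) (e ∘ γ)

variable (F) in
/-- A continuous piecewise `MC^1` curve `γ : [a, b] → M`: on each closed subinterval of a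
partition it is the restriction of an `MC^1` curve on an open set containing the
subinterval. -/
def IsPiecewiseMC1 (γ : ℝ → M) (a b : ℝ) : Prop :=
  a ≤ b ∧ ContinuousOn γ (Icc a b) ∧
    ∃ (m : ℕ) (t : ℕ → ℝ), Monotone t ∧ t 0 = a ∧ t m = b ∧
      ∀ i < m, ∃ (O : Set ℝ) (c : ℝ → M), IsOpen O ∧ Icc (t i) (t (i + 1)) ⊆ O ∧
        IsMC1Curve (F := F) O c ∧ EqOn γ c (Icc (t i) (t (i + 1)))

variable (F) in
/-- The velocity `γ'(t) ∈ T_{γ(t)} M`. -/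
def velocity (γ : ℝ → M) (t : ℝ) : Tan F M :=
  ⟨γ t, dirDeriv (chartAt F (γ t) ∘ γ) t 1⟩

/-- The length `L^n(γ) = ∫_a^b ‖γ'(t)‖^n dt`. -/
def curveLength (N : ℕ → Tan F M → ℝ) (n : ℕ) (γ : ℝ → M) (a b : ℝ) : ℝ≥0∞ :=
  ∫⁻ t in Icc a b, ENNReal.ofReal (gradedFinsler N n (velocity F γ t))

/-- The pseudo-distance `ρ^n(x, y)`: the infimum of the lengths of the continuous piecewise
`MC^1` curves from `x` to `y`. -/
def finslerPseudoDist (N : ℕ → Tan F M → ℝ) (n : ℕ) (x y : M) : ℝ≥0∞ :=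
  ⨅ (γ : ℝ → M) (a : ℝ) (b : ℝ) (_ : IsPiecewiseMC1 F γ a b ∧ γ a = x ∧ γ b = y),
    curveLength N n γ a b

/-- The Finsler metric `ρ = ∑_{n ≥ 1} 2^{-n} ρ^n / (1 + ρ^n)`; the fraction is written as
`1 - (1 + ρ^n)⁻¹`, and the index is shifted by one. -/
def finslerDist (N : ℕ → Tan F M → ℝ) (x y : M) : ℝ≥0∞ :=
  ∑' n : ℕ, ((2 : ℝ≥0∞) ^ (n + 1))⁻¹ * (1 - (1 + finslerPseudoDist N n x y)⁻¹)

/-- `B` is bounded: `sup_{a, b ∈ B} ρ(a, b) < ∞`. -/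
def IsFinslerBounded (N : ℕ → Tan F M → ℝ) (B : Set M) : Prop :=
  ⨆ a ∈ B, ⨆ b ∈ B, finslerDist N a b < ⊤

/-- Condition (WCV): the set of zeros of `ξ` in any closed bounded set is compact. -/
def ConditionWCV (N : ℕ → Tan F M → ℝ) (ξ : M → Tan F M) : Prop :=
  ∀ B : Set M, IsClosed B → IsFinslerBounded N B → IsCompact {p ∈ B | (ξ p).vec = 0}

/-! ### Functionals and critical values -/

variable (F) in
/-- A functional `l : M → ℝ` of class `MC^∞`. -/
def IsMCInftyFunctional (l : M → ℝ) : Prop :=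
  ∀ e ∈ atlas F M, MCInftyReal e.target (l ∘ e.symm)

variable (F) in
/-- `D l(p) = 0`. -/
def IsCriticalPoint (l : M → ℝ) (p : M) : Prop :=
  ∀ h : F, dirDeriv (l ∘ (chartAt F p).symm) (chartAt F p p) h = 0

variable (F) in
/-- The set `Crit_l` of critical points. -/
def critSet (l : M → ℝ) : Set M := {p | IsCriticalPoint F l p}

variable (F) in
/-- The regular values: the real numbers that are not critical values. -/
def regularValues (l : M → ℝ) : Set ℝ := (l '' critSet F l)ᶜ

/-- `l` and `ξ` are associated: `D l(p) = 0` if and only if `ξ(p) = 0`. -/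
def IsAssociated (l : M → ℝ) (ξ : M → Tan F M) : Prop :=
  ∀ p : M, IsCriticalPoint F l p ↔ (ξ p).vec = 0

end Manifold

end

end BoundedFrechet

/-!
The Finsler metric `ρ` is bounded by `1`, so that condition (WCV) applies to the whole manifold:
the zero set of `ξ`, which is the critical set of `l`, is compact. Its image under `l` is compact
as well, and it suffices to show that this image is a null set of `ℝ`, since a closed null set is
nowhere dense. By second countability this is a local question near a zero `p` of `ξ`.

At a zero, the covariant derivative of `ξ` is the derivative of its principal part `X` in a chart
(`covDeriv_eq_of_zero`), hence a Lipschitz-Fredholm operator `L`. The open mapping theorem for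
Fréchet spaces provides a parametrix `A`, with `A L = 1 - s π` for maps `s`, `π` through a
finite-dimensional space (`IsLipschitzFredholm.exists_parametrix`). The derivative of an `MC^k` map
differs from its value at `p` by operators in the connected component of `0` of the space of
Lipschitz operators. After composition with any continuous linear map to a Banach space these
operators are bounded by one and the same seminorm, the Minkowski functional of the unit ball
(`LipMapZero.exists_bound`), because the operators with this property form an open and closed
subgroup. Consequently `σ = A X` has the derivative `1 + R x - s π`, where `R x` factors through the
Banach completion of `F` for one fixed seminorm and `1 + R x` is invertible there: this is the
notion `IsReduction`, which replaces the inverse function theorem.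

The critical values on the zero set of such a `σ` are treated by the classical proof of Sard's
theorem (`IsReduction.sard`), by induction on the dimension `n` of the space through which `s π`
factors. The operators `(1 + R x)⁻¹ s` form a frame of `n` vector fields on `F`. They need not have
integral curves, but finitely many discrete Picard iterations replace these up to errors of high
order. Where the derivatives of `l` along the frame vanish up to the order `n`, it follows that `l`
is Hölder continuous of exponent `n + 1` in the coordinate `π` on the zero set of `σ`
(`IsReduction.flat_holder`), and its set of values is null because its Hausdorff dimension is at
most `n / (n + 1)`. At the other points some iterated derivative `w` of `l` vanishes and has a
nonzero derivative along the frame; then the equation `w = 0` can be added to `σ = 0`, which lowers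
the dimension by one (`IsReduction.add_equation`).
-/

namespace BoundedFrechet

noncomputable section

universe u v

/-! ### Continuous seminorms and their Banach completions -/

section Completion

variable {F : Type u} [AddCommGroup F] [Module ℝ F] [MetricSpace F] [FrechetSpace F]

instance : IsUniformAddGroup F := by
  refine ⟨?_⟩
  rw [Metric.uniformContinuous_iff]
  intro ε hε
  refine ⟨ε / 2, by positivity, ?_⟩
  rintro ⟨a, b⟩ ⟨a', b'⟩ h
  rw [Prod.dist_eq, max_lt_iff] at h
  have h1 : dist (a - b) (a' - b) = dist a a' := by
    rw [sub_eq_add_neg, sub_eq_add_neg]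
    exact StandardMetric.dist_add_right' _ _ _
  have h2 : dist (a' - b) (a' - b') = dist b b' := by
    rw [← dist_sub_zero (a' - b), ← dist_sub_zero b b', ← dist_neg_zero]
    congr 1
    abel
  calc dist (a - b) (a' - b') ≤ dist (a - b) (a' - b) + dist (a' - b) (a' - b') :=
        dist_triangle _ _ _
    _ < ε := by rw [h1, h2]; linarith [h.1, h.2]

variable (F) in
/-- The continuous seminorms of `F`. -/
def CSem : Type u := {q : Seminorm ℝ F // Continuous q}

instance : Inhabited (CSem F) := ⟨⟨0, continuous_const⟩⟩

instance : CoeFun (CSem F) (fun _ => F → ℝ) := ⟨fun q => q.1⟩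

namespace CSem

theorem continuous (q : CSem F) : Continuous q := q.2

theorem nonneg (q : CSem F) (x : F) : 0 ≤ q x := apply_nonneg q.1 x

@[simp] theorem map_zero (q : CSem F) : q 0 = 0 := _root_.map_zero q.1

theorem add_le (q : CSem F) (x y : F) : q (x + y) ≤ q x + q y := map_add_le_add q.1 x y

theorem sub_le (q : CSem F) (x y : F) : q (x - y) ≤ q x + q y := map_sub_le_add q.1 x y

theorem sub_comm (q : CSem F) (x y : F) : q (x - y) = q (y - x) := map_sub_rev q.1 x y

theorem smul (q : CSem F) (a : ℝ) (x : F) : q (a • x) = |a| * q x := map_smul_eq_mul q.1 a x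

theorem sum_le (q : CSem F) {α : Type*} (t : Finset α) (f : α → F) :
    q (∑ i ∈ t, f i) ≤ ∑ i ∈ t, q (f i) :=
  Finset.le_sum_of_subadditive q (map_zero q).le (add_le q) t f

/-- The order of continuous seminorms is the pointwise one. -/
instance : SemilatticeSup (CSem F) where
  le q r := ∀ x, q x ≤ r x
  le_refl q x := le_rfl
  le_trans q r s h h' x := (h x).trans (h' x)
  le_antisymm q r h h' := Subtype.ext (Seminorm.ext fun x => le_antisymm (h x) (h' x))
  sup q r := ⟨q.1 ⊔ r.1, by
    rw [Seminorm.coe_sup]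
    exact q.2.sup r.2⟩
  le_sup_left q r x := le_max_left (q x) (r x)
  le_sup_right q r x := le_max_right (q x) (r x)
  sup_le q r s h h' x := max_le (h x) (h' x)

/-- The seminorm `x ↦ ‖A x‖` of a continuous linear map to a normed space. -/
def ofLinear {G : Type*} [NormedAddCommGroup G] [NormedSpace ℝ G] (A : F →ₗ[ℝ] G)
    (hA : Continuous A) : CSem F :=
  ⟨(normSeminorm ℝ G).comp A, (continuous_norm.comp hA)⟩

variable (F) in
/-- The Minkowski functional of the ball of radius `r` for the metric of `F`. -/
def gaugeBall (r : ℝ) (hr : 0 < r) : CSem F :=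
  ⟨gaugeSeminorm (𝕜 := ℝ) (s := Metric.ball (0 : F) r)
      (StandardMetric.absConvex_ball r).1 (StandardMetric.absConvex_ball r).2
      (absorbent_nhds_zero (Metric.ball_mem_nhds 0 hr)),
    continuous_gauge (StandardMetric.absConvex_ball r).2 (Metric.ball_mem_nhds 0 hr)⟩

theorem dist_lt_of_gaugeBall_lt_one {r : ℝ} (hr : 0 < r) {x : F}
    (hx : gaugeBall F r hr x < 1) : dist x 0 < r := by
  have h := gaugeSeminorm_ball_one (𝕜 := ℝ) (hs₀ := (StandardMetric.absConvex_ball (F := F) r).1)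
      (hs₁ := (StandardMetric.absConvex_ball r).2)
      (hs₂ := absorbent_nhds_zero (Metric.ball_mem_nhds 0 hr)) Metric.isOpen_ball
  have h' : x ∈ Metric.ball (0 : F) r := by
    rw [← h, Seminorm.mem_ball_zero]
    exact hx
  exact h'

/-- Every neighbourhood contains a ball of a continuous seminorm. -/
theorem exists_ball_subset {x₀ : F} {O : Set F} (hO : O ∈ 𝓝 x₀) :
    ∃ q : CSem F, ∀ x, q (x - x₀) < 1 → x ∈ O := by
  obtain ⟨r, hr, h⟩ := Metric.mem_nhds_iff.1 hO
  refine ⟨gaugeBall F r hr, fun x hx => h ?_⟩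
  have := dist_lt_of_gaugeBall_lt_one hr hx
  rwa [dist_sub_zero] at this

theorem eventually_sub_lt (q : CSem F) (x₀ : F) {ε : ℝ} (hε : 0 < ε) :
    ∀ᶠ x in 𝓝 x₀, q (x - x₀) < ε := by
  have h : Continuous fun x => q (x - x₀) := q.continuous.comp (continuous_sub_right x₀)
  have h0 : q (x₀ - x₀) < ε := by simpa using hε
  exact h.continuousAt.eventually_lt continuousAt_const h0

end CSem

/-- The space `F` with the seminorm `q`. -/
def SemiSpace (_q : CSem F) : Type u := F

instance (q : CSem F) : AddCommGroup (SemiSpace q) := inferInstanceAs (AddCommGroup F)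

instance (q : CSem F) : Module ℝ (SemiSpace q) := inferInstanceAs (Module ℝ F)

instance (q : CSem F) : SeminormedAddCommGroup (SemiSpace q) :=
  AddGroupSeminorm.toSeminormedAddCommGroup (E := SemiSpace q) q.1.toAddGroupSeminorm

instance (q : CSem F) : NormedSpace ℝ (SemiSpace q) where
  norm_smul_le a x := (map_smul_eq_mul q.1 a x).le

/-- The Banach space obtained from `F` by completion with respect to the seminorm `q`. -/
abbrev BS (q : CSem F) : Type u := UniformSpace.Completion (SemiSpace q)

/-- The identity map of `F`, viewed as a map to `F` with the seminorm `q`. -/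
def toSemi (q : CSem F) : F →ₗ[ℝ] SemiSpace q where
  toFun x := x
  map_add' _ _ := rfl
  map_smul' _ _ := rfl

/-- The canonical map of `F` to its completion with respect to `q`. It is not injective in
general. -/
def iota (q : CSem F) : F →L[ℝ] BS q where
  toLinearMap := (UniformSpace.Completion.toComplL (𝕜 := ℝ) (E := SemiSpace q)).toLinearMap ∘ₗ
    toSemi q
  cont := by
    refine (UniformSpace.Completion.toComplL (𝕜 := ℝ) (E := SemiSpace q)).continuous.comp ?_
    refine continuous_of_continuousAt_zero (toSemi q) ?_
    rw [ContinuousAt, map_zero, tendsto_zero_iff_norm_tendsto_zero]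
    have := q.continuous.tendsto 0
    rwa [CSem.map_zero] at this

theorem norm_iota (q : CSem F) (x : F) : ‖iota q x‖ = q x :=
  UniformSpace.Completion.norm_coe (toSemi q x)

theorem denseRange_iota (q : CSem F) : DenseRange (iota q) :=
  UniformSpace.Completion.denseRange_coe (α := SemiSpace q)

/-- A linear map on `F` that is continuous for the seminorm `q` extends to `BS q`. -/
theorem exists_lift (q : CSem F) {H : Type*} [AddCommGroup H] [Module ℝ H] [UniformSpace H]
    [IsUniformAddGroup H] [ContinuousConstSMul ℝ H] [CompleteSpace H] [T0Space H]
    (A : F →ₗ[ℝ] H) (hA : ∀ U ∈ 𝓝 (0 : H), ∃ δ > 0, ∀ x, q x < δ → A x ∈ U) :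
    ∃ B : BS q →L[ℝ] H, ∀ x, B (iota q x) = A x := by
  let A' : SemiSpace q →L[ℝ] H :=
    { toFun := fun x => A x
      map_add' := fun x y => A.map_add x y
      map_smul' := fun a x => A.map_smul a x
      cont := by
        let A'' : SemiSpace q →+ H :=
          { toFun := fun x => A x
            map_zero' := A.map_zero
            map_add' := fun x y => A.map_add x y }
        refine continuous_of_continuousAt_zero A'' ?_
        rw [ContinuousAt, map_zero]
        intro U hU
        obtain ⟨δ, hδ, h⟩ := hA U hU
        rw [mem_map]
        filter_upwards [Metric.ball_mem_nhds (0 : SemiSpace q) hδ] with x hx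
        rw [mem_ball_zero_iff] at hx
        exact h x hx }
  have hd : DenseRange (UniformSpace.Completion.toComplL (𝕜 := ℝ) (E := SemiSpace q)) :=
    UniformSpace.Completion.denseRange_coe
  have hi : IsUniformInducing (UniformSpace.Completion.toComplL (𝕜 := ℝ) (E := SemiSpace q)) :=
    UniformSpace.Completion.isUniformInducing_coe _
  exact ⟨A'.extend (UniformSpace.Completion.toComplL (𝕜 := ℝ) (E := SemiSpace q)),
    fun x => A'.extend_eq hd hi x⟩

section Normed

variable {G : Type*} [NormedAddCommGroup G] [NormedSpace ℝ G]

theorem opNorm_le_of_iota {q : CSem F} {B : BS q →L[ℝ] G} {C : ℝ} (hC : 0 ≤ C)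
    (h : ∀ x, ‖B (iota q x)‖ ≤ C * q x) : ‖B‖ ≤ C := by
  refine B.opNorm_le_bound hC fun y => ?_
  refine (denseRange_iota q).induction_on (p := fun y => ‖B y‖ ≤ C * ‖y‖) y ?_ ?_
  · exact isClosed_le (by fun_prop) (by fun_prop)
  · intro x
    rw [norm_iota]
    exact h x

theorem exists_lift_of_bound [CompleteSpace G] (q : CSem F) (A : F →ₗ[ℝ] G) {C : ℝ}
    (hA : ∀ x, ‖A x‖ ≤ C * q x) : ∃ B : BS q →L[ℝ] G, ∀ x, B (iota q x) = A x := by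
  refine exists_lift q A fun U hU => ?_
  obtain ⟨ε, hε, h⟩ := Metric.mem_nhds_iff.1 hU
  refine ⟨ε / (|C| + 1), by positivity, fun x hx => h ?_⟩
  rw [mem_ball_zero_iff]
  rw [lt_div_iff₀ (by positivity)] at hx
  have h1 := hA x
  have h2 : C * q x ≤ |C| * q x := mul_le_mul_of_nonneg_right (le_abs_self C) (q.nonneg x)
  have h3 := q.nonneg x
  rcases h3.eq_or_lt with h3 | h3
  · rw [← h3] at h1
    linarith
  · nlinarith

end Normed

theorem ext_iota {H : Type*} [AddCommGroup H] [Module ℝ H] [TopologicalSpace H] [T2Space H]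
    {q : CSem F} {B B' : BS q →L[ℝ] H} (h : ∀ x, B (iota q x) = B' (iota q x)) : B = B' := by
  refine ContinuousLinearMap.ext fun y => ?_
  exact congrFun ((denseRange_iota q).equalizer B.continuous B'.continuous (funext h)) y

theorem exists_res {q r : CSem F} (h : q ≤ r) :
    ∃ B : BS r →L[ℝ] BS q, ∀ x, B (iota r x) = iota q x := by
  refine exists_lift_of_bound r (iota q).toLinearMap (C := 1) fun x => ?_
  change ‖iota q x‖ ≤ 1 * r x
  rw [norm_iota, one_mul]
  exact h x

/-- The canonical map between completions for comparable seminorms. -/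
def res {q r : CSem F} (h : q ≤ r) : BS r →L[ℝ] BS q := (exists_res h).choose

@[simp] theorem res_iota {q r : CSem F} (h : q ≤ r) (x : F) : res h (iota r x) = iota q x :=
  (exists_res h).choose_spec x

end Completion

/-! ### Maps with derivatives bounded by seminorms -/

section SC

variable {F : Type u} [AddCommGroup F] [Module ℝ F] [MetricSpace F] [FrechetSpace F]
  {G : Type u} [NormedAddCommGroup G] [NormedSpace ℝ G]
  {G' : Type u} [NormedAddCommGroup G'] [NormedSpace ℝ G']

/-- The directional derivatives of `P` at the points of `V` exist, and the derivative at `x` is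
the operator `B x`, which is bounded for the seminorm `q`. -/
def HasBD (V : Set F) (P : F → G) (q : CSem F) (B : F → BS q →L[ℝ] G) : Prop :=
  ∀ x ∈ V, ∀ h : F,
    Tendsto (fun t : ℝ => t⁻¹ • (P (x + t • h) - P x)) (𝓝[≠] 0) (𝓝 (B x (iota q h)))

/-- Maps to Banach spaces with `k` continuous derivatives on `V`, each of which is bounded, as an
operator, by some continuous seminorm. This seminorm may depend on the order of the derivative. -/
def SC : ℕ → ∀ {G : Type u} [NormedAddCommGroup G] [NormedSpace ℝ G], Set F → (F → G) → Prop
  | 0, _, _, _, V, P => ContinuousOn P V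
  | k + 1, G, _, _, V, P => ContinuousOn P V ∧
      ∃ (q : CSem F) (B : F → BS q →L[ℝ] G), HasBD V P q B ∧ SC k V B

theorem SC.continuousOn {k : ℕ} {V : Set F} {P : F → G} (h : SC k V P) : ContinuousOn P V := by
  cases k with
  | zero => exact h
  | succ k => exact h.1

theorem SC.mono {k : ℕ} {V W : Set F} (hW : W ⊆ V) {P : F → G} (h : SC k V P) : SC k W P := by
  induction k generalizing G with
  | zero => exact ContinuousOn.mono h hW
  | succ k ih =>
    obtain ⟨hc, q, B, hB, hS⟩ := h
    exact ⟨hc.mono hW, q, B, fun x hx => hB x (hW hx), ih hS⟩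

theorem SC.of_succ {k : ℕ} {V : Set F} {P : F → G} (h : SC (k + 1) V P) : SC k V P := by
  induction k generalizing G with
  | zero => exact h.1
  | succ k ih =>
    obtain ⟨hc, q, B, hB, hS⟩ := h
    exact ⟨hc, q, B, hB, ih hS⟩

theorem SC.of_le {k m : ℕ} (hkm : k ≤ m) {V : Set F} {P : F → G} (h : SC m V P) : SC k V P := by
  induction m, hkm using Nat.le_induction with
  | base => exact h
  | succ m _ ih => exact ih h.of_succ

theorem HasBD.hasDerivAt {V : Set F} {P : F → G} {q : CSem F} {B : F → BS q →L[ℝ] G}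
    (h : HasBD V P q B) {x : F} (v : F) {t : ℝ} (hx : x + t • v ∈ V) :
    HasDerivAt (fun t : ℝ => P (x + t • v)) (B (x + t • v) (iota q v)) t := by
  rw [hasDerivAt_iff_tendsto_slope_zero]
  refine (h _ hx v).congr fun s => ?_
  rw [add_smul, add_assoc]

theorem hasBD_of_hasDerivAt {V : Set F} {P : F → G} {q : CSem F} {B : F → BS q →L[ℝ] G}
    (h : ∀ x ∈ V, ∀ v : F, HasDerivAt (fun t : ℝ => P (x + t • v)) (B x (iota q v)) 0) :
    HasBD V P q B := by
  intro x hx v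
  have := hasDerivAt_iff_tendsto_slope_zero.1 (h x hx v)
  simpa using this

theorem HasBD.hasDerivAt_zero {V : Set F} {P : F → G} {q : CSem F} {B : F → BS q →L[ℝ] G}
    (h : HasBD V P q B) {x : F} (hx : x ∈ V) (v : F) :
    HasDerivAt (fun t : ℝ => P (x + t • v)) (B x (iota q v)) 0 := by
  have := h.hasDerivAt (x := x) v (t := 0) (by simpa using hx)
  simpa using this

theorem eventually_line_mem {V : Set F} (hV : IsOpen V) {x : F} (hx : x ∈ V) (v : F) :
    ∀ᶠ t in 𝓝 (0 : ℝ), x + t • v ∈ V := by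
  have hc : Continuous fun t : ℝ => x + t • v := by fun_prop
  refine hc.continuousAt.eventually_mem ?_
  simpa using hV.mem_nhds hx

theorem HasBD.congr {V : Set F} (hV : IsOpen V) {P P' : F → G} {q : CSem F}
    {B B' : F → BS q →L[ℝ] G} (h : HasBD V P q B) (hP : EqOn P P' V) (hB : EqOn B B' V) :
    HasBD V P' q B' := by
  refine hasBD_of_hasDerivAt fun x hx v => ?_
  rw [← hB hx]
  refine (h.hasDerivAt_zero hx v).congr_of_eventuallyEq ?_
  filter_upwards [eventually_line_mem hV hx v] with t ht
  exact (hP ht).symm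

theorem SC.congr {k : ℕ} {V : Set F} (hV : IsOpen V) {P P' : F → G} (h : SC k V P)
    (hP : EqOn P P' V) : SC k V P' := by
  cases k with
  | zero => exact ContinuousOn.congr h hP.symm
  | succ k =>
    obtain ⟨hc, q, B, hB, hS⟩ := h
    exact ⟨hc.congr hP.symm, q, B, hB.congr hV hP fun _ _ => rfl, hS⟩

/-! #### Mean value estimates -/

theorem HasBD.norm_sub_le {V : Set F} {P : F → G} {q : CSem F} {B : F → BS q →L[ℝ] G}
    (h : HasBD V P q B) {x y : F} (L : BS q →L[ℝ] G) {δ : ℝ}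
    (hV : ∀ t ∈ Icc (0 : ℝ) 1, x + t • (y - x) ∈ V)
    (hδ : ∀ t ∈ Icc (0 : ℝ) 1, ‖B (x + t • (y - x)) - L‖ ≤ δ) :
    ‖P y - P x - L (iota q (y - x))‖ ≤ δ * q (y - x) := by
  have key := norm_image_sub_le_of_norm_deriv_le_segment_01'
    (f := fun t : ℝ => P (x + t • (y - x)) - t • L (iota q (y - x)))
    (f' := fun t : ℝ => B (x + t • (y - x)) (iota q (y - x)) - (1 : ℝ) • L (iota q (y - x)))
    (C := δ * q (y - x)) ?_ ?_
  · simp only [one_smul, zero_smul, add_zero, sub_zero, add_sub_cancel] at key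
    rwa [sub_right_comm]
  · intro t ht
    exact ((h.hasDerivAt _ (hV t ht)).sub ((hasDerivAt_id t).smul_const _)).hasDerivWithinAt
  · intro t ht
    rw [one_smul, ← _root_.sub_apply, ← norm_iota q]
    exact (ContinuousLinearMap.le_opNorm _ _).trans
      (mul_le_mul_of_nonneg_right (hδ t (Ico_subset_Icc_self ht)) (norm_nonneg _))

theorem segment_mem_ball {x₀ x y : F} {r : ℝ} (hx : x ∈ Metric.ball x₀ r)
    (hy : y ∈ Metric.ball x₀ r) {t : ℝ} (ht : t ∈ Icc (0 : ℝ) 1) :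
    x + t • (y - x) ∈ Metric.ball x₀ r := by
  rw [Metric.mem_ball, ← dist_sub_zero] at *
  have h := dist_convex_zero_le (sub_nonneg.2 ht.2) ht.1 (by ring) (x - x₀) (y - x₀)
  have e : (1 - t) • (x - x₀) + t • (y - x₀) = x + t • (y - x) - x₀ := by module
  rw [e] at h
  exact h.trans_lt (max_lt hx hy)

/-- A map with continuous derivative is strictly differentiable. -/
theorem HasBD.strict {V : Set F} (hV : IsOpen V) {P : F → G} {q : CSem F}
    {B : F → BS q →L[ℝ] G} (h : HasBD V P q B) (hB : ContinuousOn B V) {x₀ : F} (hx₀ : x₀ ∈ V)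
    {ε : ℝ} (hε : 0 < ε) :
    ∃ r > 0, Metric.ball x₀ r ⊆ V ∧ ∀ x ∈ Metric.ball x₀ r, ∀ y ∈ Metric.ball x₀ r,
      ‖P y - P x - B x₀ (iota q (y - x))‖ ≤ ε * q (y - x) := by
  have h1 : ∀ᶠ x in 𝓝 x₀, ‖B x - B x₀‖ < ε := by
    have := (hB.continuousAt (hV.mem_nhds hx₀)).sub (continuousAt_const (y := B x₀))
    have h2 := this.norm
    refine h2.eventually_lt continuousAt_const ?_
    simpa using hε
  obtain ⟨r, hr, hr'⟩ := Metric.mem_nhds_iff.1 (h1.and (hV.mem_nhds hx₀))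
  refine ⟨r, hr, fun x hx => (hr' hx).2, fun x hx y hy => ?_⟩
  refine h.norm_sub_le _ (fun t ht => (hr' (segment_mem_ball hx hy ht)).2) fun t ht => ?_
  exact (hr' (segment_mem_ball hx hy ht)).1.le

theorem HasBD.lip {V : Set F} (hV : IsOpen V) {P : F → G} {q : CSem F}
    {B : F → BS q →L[ℝ] G} (h : HasBD V P q B) (hB : ContinuousOn B V) {x₀ : F} (hx₀ : x₀ ∈ V) :
    ∃ C ≥ 0, ∃ r > 0, Metric.ball x₀ r ⊆ V ∧ ∀ x ∈ Metric.ball x₀ r, ∀ y ∈ Metric.ball x₀ r,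
      ‖P y - P x‖ ≤ C * q (y - x) := by
  obtain ⟨r, hr, hrV, H⟩ := h.strict hV hB hx₀ one_pos
  refine ⟨‖B x₀‖ + 1, by positivity, r, hr, hrV, fun x hx y hy => ?_⟩
  have h1 := H x hx y hy
  have h2 := (B x₀).le_opNorm (iota q (y - x))
  rw [norm_iota] at h2
  calc ‖P y - P x‖ = ‖(P y - P x - B x₀ (iota q (y - x))) + B x₀ (iota q (y - x))‖ := by
        rw [sub_add_cancel]
    _ ≤ _ := norm_add_le _ _
    _ ≤ (‖B x₀‖ + 1) * q (y - x) := by linarith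

theorem SC.lip {V : Set F} (hV : IsOpen V) {P : F → G} (h : SC 1 V P) {x₀ : F} (hx₀ : x₀ ∈ V) :
    ∃ q : CSem F, ∃ C ≥ 0, ∃ r > 0, Metric.ball x₀ r ⊆ V ∧
      ∀ x ∈ Metric.ball x₀ r, ∀ y ∈ Metric.ball x₀ r, ‖P y - P x‖ ≤ C * q (y - x) := by
  obtain ⟨-, q, B, hB, hS⟩ := h
  exact ⟨q, hB.lip hV hS hx₀⟩

/-- Taylor's formula of order two. -/
theorem HasBD.taylor {V : Set F} (hV : IsOpen V) {P : F → G} {q : CSem F}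
    {B : F → BS q →L[ℝ] G} (h : HasBD V P q B) (hB : SC 1 V B) {x₀ : F} (hx₀ : x₀ ∈ V) :
    ∃ r : CSem F, ∃ C ≥ 0, ∃ ε > 0, Metric.ball x₀ ε ⊆ V ∧
      ∀ x ∈ Metric.ball x₀ ε, ∀ y ∈ Metric.ball x₀ ε,
        ‖P y - P x - B x (iota q (y - x))‖ ≤ C * r (y - x) ^ 2 := by
  obtain ⟨r, C, hC, ε, hε, hεV, H⟩ := hB.lip hV hx₀
  refine ⟨q ⊔ r, C, hC, ε, hε, hεV, fun x hx y hy => ?_⟩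
  have hr : r (y - x) ≤ (q ⊔ r) (y - x) := (le_sup_right : r ≤ q ⊔ r) _
  have hq : q (y - x) ≤ (q ⊔ r) (y - x) := (le_sup_left : q ≤ q ⊔ r) _
  have h0 := (q ⊔ r).nonneg (y - x)
  have h1 := h.norm_sub_le (x := x) (y := y) (B x) (δ := C * r (y - x))
    (fun t ht => hεV (segment_mem_ball hx hy ht)) fun t ht => ?_
  · refine h1.trans ?_
    rw [pow_two, mul_assoc]
    gcongr
  · refine (H x hx _ (segment_mem_ball hx hy ht)).trans ?_
    rw [add_sub_cancel_left, CSem.smul, abs_of_nonneg ht.1]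
    exact mul_le_mul_of_nonneg_left (mul_le_of_le_one_left (r.nonneg _) ht.2) hC

/-! #### Closure properties -/

theorem SC.const (k : ℕ) (V : Set F) (c : G) : SC k V fun _ => c := by
  induction k generalizing G with
  | zero => exact continuousOn_const
  | succ k ih =>
    refine ⟨continuousOn_const, (default : CSem F), fun _ => 0, fun x _ h => ?_, ih 0⟩
    simp

theorem SC.clm {k : ℕ} {V : Set F} {P : F → G} (h : SC k V P) (A : G →L[ℝ] G') :
    SC k V fun x => A (P x) := by
  induction k generalizing G G' with
  | zero => exact A.continuous.comp_continuousOn h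
  | succ k ih =>
    obtain ⟨hc, q, B, hB, hS⟩ := h
    refine ⟨A.continuous.comp_continuousOn hc, q, fun x => A.comp (B x), ?_,
      ih hS (ContinuousLinearMap.compL ℝ (BS q) G G' A)⟩
    exact hasBD_of_hasDerivAt fun x hx v =>
      A.hasFDerivAt.comp_hasDerivAt (0 : ℝ) (hB.hasDerivAt_zero hx v)

theorem SC.prodMk {k : ℕ} {V : Set F} {P : F → G} {Q : F → G'} (h : SC k V P) (h' : SC k V Q) :
    SC k V fun x => (P x, Q x) := by
  induction k generalizing G G' with
  | zero => exact ContinuousOn.prodMk h h'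
  | succ k ih =>
    obtain ⟨hc, q, B, hB, hS⟩ := h
    obtain ⟨hc', q', B', hB', hS'⟩ := h'
    let Φ : (BS q →L[ℝ] G) × (BS q' →L[ℝ] G') →L[ℝ] (BS (q ⊔ q') →L[ℝ] G × G') :=
      (((ContinuousLinearMap.compL ℝ (BS (q ⊔ q')) G (G × G')) (.inl ℝ G G')) ∘L
        (ContinuousLinearMap.compL ℝ (BS (q ⊔ q')) (BS q) G).flip (res le_sup_left)).coprod
      (((ContinuousLinearMap.compL ℝ (BS (q ⊔ q')) G' (G × G')) (.inr ℝ G G')) ∘L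
        (ContinuousLinearMap.compL ℝ (BS (q ⊔ q')) (BS q') G').flip (res le_sup_right))
    refine ⟨hc.prodMk hc', q ⊔ q', fun x => Φ (B x, B' x), ?_, (ih hS hS').clm Φ⟩
    refine hasBD_of_hasDerivAt fun x hx v => ?_
    have e : Φ (B x, B' x) (iota (q ⊔ q') v) = (B x (iota q v), B' x (iota q' v)) := by
      simp [Φ]
    rw [e]
    exact (hB.hasDerivAt_zero hx v).prodMk (hB'.hasDerivAt_zero hx v)

theorem SC.contDiffAt_comp {k : ℕ} {V : Set F} {P : F → G} (h : SC k V P) {Φ : G → G'}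
    (hΦ : ∀ x ∈ V, ContDiffAt ℝ k Φ (P x)) : SC k V fun x => Φ (P x) := by
  induction k generalizing G G' with
  | zero =>
    intro x hx
    exact (hΦ x hx).continuousAt.comp_continuousWithinAt (h x hx)
  | succ k ih =>
    obtain ⟨hc, q, B, hB, hS⟩ := id h
    have hc' : ContinuousOn (fun x => Φ (P x)) V := fun x hx =>
      (hΦ x hx).continuousAt.comp_continuousWithinAt (hc x hx)
    refine ⟨hc', q, fun x => (fderiv ℝ Φ (P x)).comp (B x), ?_, ?_⟩
    · refine hasBD_of_hasDerivAt fun x hx v => ?_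
      have h1 : HasFDerivAt Φ (fderiv ℝ Φ (P x)) (P (x + (0 : ℝ) • v)) := by
        rw [zero_smul, add_zero]
        exact ((hΦ x hx).differentiableAt (by simp)).hasFDerivAt
      exact h1.comp_hasDerivAt (0 : ℝ) (hB.hasDerivAt_zero hx v)
    · refine ih (G := G × (BS q →L[ℝ] G)) (h.of_succ.prodMk hS)
        (Φ := fun z => (fderiv ℝ Φ z.1).comp z.2) fun x hx => ?_
      have h1 : ContDiffAt ℝ k (fderiv ℝ Φ) (P x) := (hΦ x hx).fderiv_right (by norm_cast)
      refine ContDiffAt.clm_comp ?_ contDiffAt_snd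
      exact h1.comp (P x, B x) contDiffAt_fst

theorem SC.contDiff_comp {k : ℕ} {V : Set F} {P : F → G} (h : SC k V P) {Φ : G → G'}
    (hΦ : ContDiff ℝ k Φ) : SC k V fun x => Φ (P x) :=
  h.contDiffAt_comp fun _ _ => hΦ.contDiffAt

theorem SC.add {k : ℕ} {V : Set F} {P Q : F → G} (h : SC k V P) (h' : SC k V Q) :
    SC k V fun x => P x + Q x :=
  (h.prodMk h').contDiff_comp (Φ := fun z => z.1 + z.2) (contDiff_fst.add contDiff_snd)

end SC

/-! ### Discrete Picard iteration along a frame of vector fields -/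

section Picard

variable {F : Type u} [AddCommGroup F] [Module ℝ F] [MetricSpace F] [FrechetSpace F]
  {G : Type u} [NormedAddCommGroup G] [NormedSpace ℝ G]
  {N : Type} [NormedAddCommGroup N] [NormedSpace ℝ N]

/-- Picard iterates, with `M` time steps, for the differential equation `c' = v(c) η` on `[0, 1]`
with initial value `x`: the value of the `i`-th iterate at the time `l / M`. The integrals are
replaced by Riemann sums; for `M = 0` all iterates are constant. -/
def picard (v : F → N →L[ℝ] F) (M : ℕ) (x : F) (η : N) : ℕ → ℕ → F
  | 0, _ => x
  | i + 1, l => x + (M : ℝ)⁻¹ • ∑ j ∈ Finset.range l, v (picard v M x η i j) η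

variable {v : F → N →L[ℝ] F} {V : Set F} {x₀ : F}

theorem picard_zero_time (M : ℕ) (x : F) (η : N) (i : ℕ) : picard v M x η i 0 = x := by
  cases i <;> simp [picard]

theorem picard_succ_time (M : ℕ) (x : F) (η : N) (i l : ℕ) :
    picard v M x η (i + 1) (l + 1) =
      picard v M x η (i + 1) l + (M : ℝ)⁻¹ • v (picard v M x η i l) η := by
  simp only [picard, Finset.sum_range_succ, smul_add, add_assoc]

theorem inv_mul_le_one_of_le {l M : ℕ} (h : l ≤ M) : (M : ℝ)⁻¹ * l ≤ 1 := by
  rcases Nat.eq_zero_or_pos M with rfl | hM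
  · simp
  · rw [inv_mul_le_iff₀ (by exact_mod_cast hM), mul_one]
    exact_mod_cast h

theorem CSem.average_le (q : CSem F) {l M : ℕ} (h : l ≤ M) {f : ℕ → F} {D : ℝ} (hD : 0 ≤ D)
    (hf : ∀ j < l, q (f j) ≤ D) : q ((M : ℝ)⁻¹ • ∑ j ∈ Finset.range l, f j) ≤ D := by
  rw [CSem.smul, abs_of_nonneg (by positivity)]
  have h1 : q (∑ j ∈ Finset.range l, f j) ≤ l * D := by
    refine (q.sum_le _ _).trans ((Finset.sum_le_sum fun j hj => hf j (Finset.mem_range.1 hj)).trans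
      ?_)
    simp
  calc (M : ℝ)⁻¹ * q (∑ j ∈ Finset.range l, f j) ≤ (M : ℝ)⁻¹ * (l * D) := by gcongr
    _ = ((M : ℝ)⁻¹ * l) * D := by ring
    _ ≤ 1 * D := by gcongr; exact inv_mul_le_one_of_le h
    _ = D := one_mul D

theorem eventually_norm_le {X E : Type*} [TopologicalSpace X] [NormedAddCommGroup E] {P : X → E}
    {V : Set X} {x₀ : X} (hV : IsOpen V)
    (hP : ContinuousOn P V) (hx₀ : x₀ ∈ V) : ∃ C ≥ 0, ∀ᶠ x in 𝓝 x₀, ‖P x‖ ≤ C := by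
  refine ⟨‖P x₀‖ + 1, by positivity, ?_⟩
  have h := (hP.continuousAt (hV.mem_nhds hx₀)).norm
  filter_upwards [h.eventually_lt (continuousAt_const (y := ‖P x₀‖ + 1)) (by simp)] with x hx
  exact hx.le

theorem eventually_frame_le (hV : IsOpen V) (hx₀ : x₀ ∈ V)
    (hv : ∀ q : CSem F, SC 1 V fun x => (iota q).comp (v x)) (q : CSem F) :
    ∃ C ≥ 0, ∀ᶠ x in 𝓝 x₀, ∀ η, q (v x η) ≤ C * ‖η‖ := by
  obtain ⟨C, hC, h⟩ := eventually_norm_le hV (hv q).continuousOn hx₀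
  refine ⟨C, hC, h.mono fun x hx η => ?_⟩
  rw [← norm_iota]
  exact ((iota q).comp (v x)).le_of_opNorm_le hx η

theorem frame_lip (hV : IsOpen V) (hx₀ : x₀ ∈ V)
    (hv : ∀ q : CSem F, SC 1 V fun x => (iota q).comp (v x)) (q : CSem F) :
    ∃ r : CSem F, ∃ C ≥ 0, ∃ O ∈ 𝓝 x₀, ∀ x ∈ O, ∀ y ∈ O, ∀ η,
      q (v y η - v x η) ≤ C * r (y - x) * ‖η‖ := by
  obtain ⟨r, C, hC, ε, hε, -, h⟩ := (hv q).lip hV hx₀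
  refine ⟨r, C, hC, _, Metric.ball_mem_nhds x₀ hε, fun x hx y hy η => ?_⟩
  have h1 := ContinuousLinearMap.le_of_opNorm_le _ (h x hx y hy) η
  rw [← norm_iota, map_sub]
  exact h1

/-- All Picard iterates stay near `x₀` if they start near `x₀` in a small direction. -/
theorem picard_mem (hV : IsOpen V) (hx₀ : x₀ ∈ V)
    (hv : ∀ q : CSem F, SC 1 V fun x => (iota q).comp (v x)) (i : ℕ) {O : Set F}
    (hO : O ∈ 𝓝 x₀) :
    ∀ᶠ z in 𝓝 x₀ ×ˢ 𝓝 (0 : N), ∀ M : ℕ, ∀ l ≤ M, picard v M z.1 z.2 i l ∈ O := by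
  induction i generalizing O with
  | zero =>
    filter_upwards [tendsto_fst.eventually hO] with z hz M l _
    exact hz
  | succ i ih =>
    obtain ⟨q, hq⟩ := CSem.exists_ball_subset hO
    obtain ⟨C, hC, hC'⟩ := eventually_frame_le hV hx₀ hv q
    have h1 : ∀ᶠ η in 𝓝 (0 : N), C * ‖η‖ < 1 / 2 := by
      have : Continuous fun η : N => C * ‖η‖ := by fun_prop
      exact this.continuousAt.eventually_lt continuousAt_const (by simp)
    filter_upwards [ih hC', tendsto_fst.eventually (q.eventually_sub_lt x₀ one_half_pos),
      tendsto_snd.eventually h1] with z hz1 hz2 hz3 M l hl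
    refine hq _ ?_
    have h2 : q ((M : ℝ)⁻¹ • ∑ j ∈ Finset.range l, v (picard v M z.1 z.2 i j) z.2) ≤ C * ‖z.2‖ :=
      q.average_le hl (by positivity) fun j hj => hz1 M j (hj.le.trans hl) z.2
    have h3 := q.add_le (z.1 - x₀)
      ((M : ℝ)⁻¹ • ∑ j ∈ Finset.range l, v (picard v M z.1 z.2 i j) z.2)
    rw [sub_add_eq_add_sub] at h3
    simp only [picard]
    linarith

/-- Consecutive Picard iterates agree to increasing order in `η`. -/
theorem picard_sub_le (hV : IsOpen V) (hx₀ : x₀ ∈ V)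
    (hv : ∀ q : CSem F, SC 1 V fun x => (iota q).comp (v x)) (i : ℕ) (q : CSem F) :
    ∃ C ≥ 0, ∀ᶠ z in 𝓝 x₀ ×ˢ 𝓝 (0 : N), ∀ M : ℕ, ∀ l ≤ M,
      q (picard v M z.1 z.2 (i + 1) l - picard v M z.1 z.2 i l) ≤ C * ‖z.2‖ ^ (i + 1) := by
  induction i generalizing q with
  | zero =>
    obtain ⟨C, hC, hC'⟩ := eventually_frame_le hV hx₀ hv q
    refine ⟨C, hC, ?_⟩
    filter_upwards [tendsto_fst.eventually hC'] with z hz M l hl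
    simp only [picard, add_sub_cancel_left, zero_add, pow_one]
    exact q.average_le hl (by positivity) fun j _ => hz z.2
  | succ i ih =>
    obtain ⟨r, C, hC, O, hO, h⟩ := frame_lip hV hx₀ hv q
    obtain ⟨C', hC', h'⟩ := ih r
    refine ⟨C * C', by positivity, ?_⟩
    filter_upwards [h', picard_mem hV hx₀ hv i hO, picard_mem hV hx₀ hv (i + 1) hO]
      with z hz h1 h2 M l hl
    have e : picard v M z.1 z.2 (i + 1 + 1) l - picard v M z.1 z.2 (i + 1) l =
        (M : ℝ)⁻¹ • ∑ j ∈ Finset.range l,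
          (v (picard v M z.1 z.2 (i + 1) j) z.2 - v (picard v M z.1 z.2 i j) z.2) := by
      rw [Finset.sum_sub_distrib, smul_sub]
      conv_lhs => rw [picard]
      conv_lhs => rw [picard]
      rw [add_sub_add_left_eq_sub]
    rw [e]
    refine q.average_le hl (by positivity) fun j hj => ?_
    have hjM := hj.le.trans hl
    refine (h _ (h1 M j hjM) _ (h2 M j hjM) z.2).trans ?_
    calc C * r (picard v M z.1 z.2 (i + 1) j - picard v M z.1 z.2 i j) * ‖z.2‖
        ≤ C * (C' * ‖z.2‖ ^ (i + 1)) * ‖z.2‖ := by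
          gcongr
          exact hz M j hjM
      _ = C * C' * ‖z.2‖ ^ (i + 1 + 1) := by ring

/-- One time step of length `1 / M` changes `w` by its derivative along the vector field. The second
order Taylor remainder is absorbed by the assumption on `M`, and the difference of the consecutive
iterates `k` and `k + 1` by `picard_sub_le`. -/
theorem picard_step_le (hV : IsOpen V) (hx₀ : x₀ ∈ V)
    (hv : ∀ q : CSem F, SC 1 V fun x => (iota q).comp (v x)) (k : ℕ) {w : F → G} {q : CSem F}
    {B : F → BS q →L[ℝ] G} (hw : HasBD V w q B) (hB : SC 1 V B) :
    ∃ C ≥ 0, ∀ᶠ z in 𝓝 x₀ ×ˢ 𝓝 (0 : N), ∀ M : ℕ, (M : ℝ)⁻¹ ≤ ‖z.2‖ ^ k → ∀ l < M,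
      ‖w (picard v M z.1 z.2 (k + 1) (l + 1)) - w (picard v M z.1 z.2 (k + 1) l) -
        (M : ℝ)⁻¹ • B (picard v M z.1 z.2 (k + 1) l)
          (iota q (v (picard v M z.1 z.2 (k + 1) l) z.2))‖ ≤
        (M : ℝ)⁻¹ * (C * ‖z.2‖ ^ (k + 1)) := by
  obtain ⟨r, C₁, hC₁, ε, hε, -, hT⟩ := hw.taylor hV hB hx₀
  obtain ⟨C₂, hC₂, h₂⟩ := eventually_frame_le hV hx₀ hv r
  obtain ⟨C₃, hC₃, h₃⟩ := eventually_norm_le hV hB.continuousOn hx₀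
  obtain ⟨s, C₄, hC₄, O, hO, h₄⟩ := frame_lip hV hx₀ hv q
  obtain ⟨C₅, hC₅, h₅⟩ := picard_sub_le hV hx₀ hv k s
  refine ⟨C₁ * C₂ ^ 2 + C₃ * (C₄ * C₅), by positivity, ?_⟩
  have hη : ∀ᶠ η in 𝓝 (0 : N), ‖η‖ < 1 :=
    continuous_norm.continuousAt.eventually_lt continuousAt_const (by simp)
  filter_upwards [h₅, tendsto_snd.eventually hη,
    picard_mem hV hx₀ hv k (inter_mem h₂ hO),
    picard_mem hV hx₀ hv (k + 1) (inter_mem (inter_mem h₃ hO) (Metric.ball_mem_nhds x₀ hε))]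
    with z hz5 hz1 hk hk' M hM l hl
  obtain ⟨hk2, hkO⟩ := hk M l hl.le
  obtain ⟨⟨hk3, hkO'⟩, hkε⟩ := hk' M l hl.le
  obtain ⟨-, hkε'⟩ := hk' M (l + 1) hl
  have hT' := hT _ hkε _ hkε'
  have hstep := picard_succ_time (v := v) M z.1 z.2 k l
  set c := picard v M z.1 z.2 (k + 1) l
  set b := picard v M z.1 z.2 k l
  rw [hstep, add_sub_cancel_left] at hT'
  rw [hstep]
  have hn0 := norm_nonneg z.2
  have hM0 : (0 : ℝ) ≤ (M : ℝ)⁻¹ := by positivity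
  have hpow : ‖z.2‖ ^ (k + 2) ≤ ‖z.2‖ ^ (k + 1) :=
    pow_le_pow_of_le_one hn0 hz1.le (by omega)
  have e1 : C₁ * r ((M : ℝ)⁻¹ • v b z.2) ^ 2 ≤ (M : ℝ)⁻¹ * (C₁ * C₂ ^ 2 * ‖z.2‖ ^ (k + 1)) := by
    rw [CSem.smul, abs_of_nonneg hM0]
    calc C₁ * ((M : ℝ)⁻¹ * r (v b z.2)) ^ 2 ≤ C₁ * ((M : ℝ)⁻¹ * (C₂ * ‖z.2‖)) ^ 2 := by
          have := r.nonneg (v b z.2)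
          gcongr
          exact hk2 z.2
      _ = (M : ℝ)⁻¹ * (C₁ * C₂ ^ 2 * ((M : ℝ)⁻¹ * ‖z.2‖ ^ 2)) := by ring
      _ ≤ (M : ℝ)⁻¹ * (C₁ * C₂ ^ 2 * (‖z.2‖ ^ k * ‖z.2‖ ^ 2)) := by gcongr
      _ = (M : ℝ)⁻¹ * (C₁ * C₂ ^ 2 * ‖z.2‖ ^ (k + 2)) := by ring
      _ ≤ _ := by gcongr
  have e2 : ‖B c (iota q ((M : ℝ)⁻¹ • v b z.2)) - (M : ℝ)⁻¹ • B c (iota q (v c z.2))‖ ≤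
      (M : ℝ)⁻¹ * (C₃ * (C₄ * C₅) * ‖z.2‖ ^ (k + 1)) := by
    rw [map_smul, map_smul, ← smul_sub, ← map_sub, ← map_sub, norm_smul, Real.norm_eq_abs,
      abs_of_nonneg hM0]
    refine mul_le_mul_of_nonneg_left ?_ hM0
    have h6 := hz5 M l hl.le
    have h7 := h₄ _ hkO' _ hkO z.2
    rw [s.sub_comm] at h7
    calc ‖B c (iota q (v b z.2 - v c z.2))‖ ≤ C₃ * q (v b z.2 - v c z.2) := by
          rw [← norm_iota q]
          exact (B c).le_of_opNorm_le hk3 _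
      _ ≤ C₃ * (C₄ * (C₅ * ‖z.2‖ ^ (k + 1)) * ‖z.2‖) := by
          gcongr
          refine h7.trans ?_
          gcongr
      _ = C₃ * (C₄ * C₅) * ‖z.2‖ ^ (k + 2) := by ring
      _ ≤ _ := by gcongr
  have e3 : ∀ a b' c' : G, a - c' = (a - b') + (b' - c') := fun a b' c' => by abel
  rw [e3 _ (B c (iota q ((M : ℝ)⁻¹ • v b z.2)))]
  refine (norm_add_le _ _).trans ((add_le_add (hT'.trans e1) e2).trans (le_of_eq ?_))
  ring

/-- The value of `w` along the Picard iterates is the integral of its derivative along the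
vector field, up to an error of order `k + 1`. -/
theorem picard_sum_le (hV : IsOpen V) (hx₀ : x₀ ∈ V)
    (hv : ∀ q : CSem F, SC 1 V fun x => (iota q).comp (v x)) (k : ℕ) {w : F → G} {q : CSem F}
    {B : F → BS q →L[ℝ] G} (hw : HasBD V w q B) (hB : SC 1 V B) :
    ∃ C ≥ 0, ∀ᶠ z in 𝓝 x₀ ×ˢ 𝓝 (0 : N), ∀ M : ℕ, (M : ℝ)⁻¹ ≤ ‖z.2‖ ^ k → ∀ l ≤ M,
      ‖w (picard v M z.1 z.2 (k + 1) l) - w z.1 -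
        (M : ℝ)⁻¹ • ∑ j ∈ Finset.range l, B (picard v M z.1 z.2 (k + 1) j)
          (iota q (v (picard v M z.1 z.2 (k + 1) j) z.2))‖ ≤ C * ‖z.2‖ ^ (k + 1) := by
  obtain ⟨C, hC, h⟩ := picard_step_le hV hx₀ hv k hw hB
  refine ⟨C, hC, h.mono fun z hz M hM l hl => ?_⟩
  have key : ∀ l ≤ M, ‖w (picard v M z.1 z.2 (k + 1) l) - w z.1 -
        (M : ℝ)⁻¹ • ∑ j ∈ Finset.range l, B (picard v M z.1 z.2 (k + 1) j)
          (iota q (v (picard v M z.1 z.2 (k + 1) j) z.2))‖ ≤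
          (M : ℝ)⁻¹ * l * (C * ‖z.2‖ ^ (k + 1)) := by
    intro l
    induction l with
    | zero =>
      intro _
      simp [picard_zero_time]
    | succ l ih =>
      intro hl
      have h1 := ih (Nat.le_of_succ_le hl)
      have h2 := hz M hM l hl
      rw [Finset.sum_range_succ, smul_add]
      have e : ∀ a b c d f : G, a - b - (c + d) = (f - b - c) + (a - f - d) :=
        fun a b c d f => by abel
      rw [e _ _ _ _ (w (picard v M z.1 z.2 (k + 1) l))]
      refine (norm_add_le _ _).trans ((add_le_add h1 h2).trans (le_of_eq ?_))
      push_cast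
      ring
  refine (key l hl).trans ?_
  calc (M : ℝ)⁻¹ * l * (C * ‖z.2‖ ^ (k + 1)) ≤ 1 * (C * ‖z.2‖ ^ (k + 1)) := by
        gcongr
        exact inv_mul_le_one_of_le hl
    _ = _ := one_mul _

/-! #### Iterated derivatives along the frame -/

open Classical in
/-- The derivative of `w` along the frame `v`, a map with values in the linear maps `N → G`. It is
zero where the directional derivatives do not exist or are not given by a continuous linear map. -/
def plus (v : F → N →L[ℝ] F) (w : F → G) (x : F) : N →L[ℝ] G :=
  if h : ∃ L : N →L[ℝ] G, ∀ η,
      Tendsto (fun t : ℝ => t⁻¹ • (w (x + t • v x η) - w x)) (𝓝[≠] 0) (𝓝 (L η))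
  then h.choose else 0

theorem HasBD.plus_eq {w : F → G} {q : CSem F} {B : F → BS q →L[ℝ] G} (hw : HasBD V w q B)
    {x : F} (hx : x ∈ V) : plus v w x = (B x).comp ((iota q).comp (v x)) := by
  have h : ∃ L : N →L[ℝ] G, ∀ η,
      Tendsto (fun t : ℝ => t⁻¹ • (w (x + t • v x η) - w x)) (𝓝[≠] 0) (𝓝 (L η)) :=
    ⟨(B x).comp ((iota q).comp (v x)), fun η => hw x hx (v x η)⟩
  rw [plus, dif_pos h]
  exact ContinuousLinearMap.ext fun η =>
    tendsto_nhds_unique (h.choose_spec η) (hw x hx (v x η))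

theorem SC.plus {m : ℕ} (hV : IsOpen V) {w : F → G} (hw : SC (m + 1) V w)
    (hv : ∀ q : CSem F, SC m V fun x => (iota q).comp (v x)) : SC m V (plus v w) := by
  obtain ⟨-, q, B, hB, hS⟩ := hw
  have h := (hS.prodMk (hv q)).contDiff_comp (Φ := fun z => z.1.comp z.2)
    (contDiff_fst.clm_comp contDiff_snd)
  exact h.congr hV fun x hx => (hB.plus_eq hx).symm

/-- The derivatives of `w` along the frame `v` at `x`, of the orders `1` to `j`, vanish. -/
def Flat (v : F → N →L[ℝ] F) : ℕ → ∀ {G : Type u} [NormedAddCommGroup G] [NormedSpace ℝ G],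
    (F → G) → F → Prop
  | 0, _, _, _, _, _ => True
  | j + 1, _, _, _, w, x => plus v w x = 0 ∧ Flat v j (plus v w) x

/-- A map that is flat to order `j` at `x` varies along the Picard iterates starting at `x` only
to order `j + 1`. -/
theorem Flat.picard_le (hV : IsOpen V) (hx₀ : x₀ ∈ V) (k j : ℕ) (hjk : j ≤ k)
    (hv : ∀ q : CSem F, SC (j + 2) V fun x => (iota q).comp (v x)) {w : F → G}
    (hw : SC (j + 2) V w) :
    ∃ C ≥ 0, ∀ᶠ z in 𝓝 x₀ ×ˢ 𝓝 (0 : N), Flat v j w z.1 →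
      ∀ M : ℕ, (M : ℝ)⁻¹ ≤ ‖z.2‖ ^ k → ∀ l ≤ M,
        ‖w (picard v M z.1 z.2 (k + 1) l) - w z.1‖ ≤ C * ‖z.2‖ ^ (j + 1) := by
  induction j generalizing G with
  | zero =>
    have hv1 : ∀ q : CSem F, SC 1 V fun x => (iota q).comp (v x) :=
      fun q => (hv q).of_le (by omega)
    obtain ⟨q, C, hC, ε, hε, -, h⟩ := (hw.of_le (k := 1) (by omega)).lip hV hx₀
    obtain ⟨C', hC', h'⟩ := eventually_frame_le hV hx₀ hv1 q
    refine ⟨C * C', by positivity, ?_⟩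
    filter_upwards [picard_mem hV hx₀ hv1 k h',
      picard_mem hV hx₀ hv1 (k + 1) (Metric.ball_mem_nhds x₀ hε)] with z hz hz' _ M _ l hl
    have h0 := hz' M 0 (Nat.zero_le _)
    rw [picard_zero_time] at h0
    refine (h _ h0 _ (hz' M l hl)).trans ?_
    rw [picard, add_sub_cancel_left, mul_assoc]
    refine mul_le_mul_of_nonneg_left ?_ hC
    rw [zero_add, pow_one]
    exact q.average_le hl (by positivity) fun i hi => hz M i (hi.le.trans hl) z.2
  | succ j ih =>
    have hv1 : ∀ q : CSem F, SC 1 V fun x => (iota q).comp (v x) :=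
      fun q => (hv q).of_le (by omega)
    have hp : SC (j + 2) V (BoundedFrechet.plus v w) := hw.plus hV fun q => (hv q).of_succ
    obtain ⟨C, hC, h⟩ := ih (by omega) (fun q => (hv q).of_succ) hp
    obtain ⟨-, q, B, hB, hS⟩ := id hw
    obtain ⟨C', hC', h'⟩ := picard_sum_le hV hx₀ hv1 k hB (hS.of_le (by omega))
    refine ⟨C' + C, by positivity, ?_⟩
    have hη : ∀ᶠ η in 𝓝 (0 : N), ‖η‖ < 1 :=
      continuous_norm.continuousAt.eventually_lt continuousAt_const (by simp)
    filter_upwards [h, h', tendsto_snd.eventually hη, picard_mem hV hx₀ hv1 (k + 1)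
      (hV.mem_nhds hx₀)] with z hz hz' hz1 hzV hflat M hM l hl
    have h1 := hz' M hM l hl
    have hpow : ‖z.2‖ ^ (k + 1) ≤ ‖z.2‖ ^ (j + 1 + 1) :=
      pow_le_pow_of_le_one (norm_nonneg _) hz1.le (by omega)
    have h2 : ‖(M : ℝ)⁻¹ • ∑ i ∈ Finset.range l, B (picard v M z.1 z.2 (k + 1) i)
          (iota q (v (picard v M z.1 z.2 (k + 1) i) z.2))‖ ≤ C * ‖z.2‖ ^ (j + 1 + 1) := by
      have h3 : ∀ i ∈ Finset.range l, ‖B (picard v M z.1 z.2 (k + 1) i)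
          (iota q (v (picard v M z.1 z.2 (k + 1) i) z.2))‖ ≤ C * ‖z.2‖ ^ (j + 1 + 1) := by
        intro i hi
        have hiM := (Finset.mem_range.1 hi).le.trans hl
        have h4 := hz hflat.2 M hM i hiM
        rw [hflat.1, sub_zero] at h4
        have h5 := ContinuousLinearMap.le_of_opNorm_le _ h4 z.2
        rw [hB.plus_eq (hzV M i hiM)] at h5
        refine h5.trans (le_of_eq ?_)
        ring
      have h6 := Finset.sum_le_sum h3
      rw [norm_smul, Real.norm_eq_abs, abs_of_nonneg (by positivity)]
      calc (M : ℝ)⁻¹ * ‖∑ i ∈ Finset.range l, B (picard v M z.1 z.2 (k + 1) i)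
              (iota q (v (picard v M z.1 z.2 (k + 1) i) z.2))‖
          ≤ (M : ℝ)⁻¹ * (l * (C * ‖z.2‖ ^ (j + 1 + 1))) := by
            gcongr
            refine (norm_sum_le _ _).trans (h6.trans ?_)
            simp
        _ = ((M : ℝ)⁻¹ * l) * (C * ‖z.2‖ ^ (j + 1 + 1)) := by ring
        _ ≤ 1 * (C * ‖z.2‖ ^ (j + 1 + 1)) := by
            gcongr
            exact inv_mul_le_one_of_le hl
        _ = _ := one_mul _
    have e : ∀ a b c : G, a - b = (a - b - c) + c := fun a b c => by abel
    rw [e _ _ ((M : ℝ)⁻¹ • ∑ i ∈ Finset.range l, B (picard v M z.1 z.2 (k + 1) i)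
          (iota q (v (picard v M z.1 z.2 (k + 1) i) z.2)))]
    refine (norm_add_le _ _).trans ((add_le_add h1 h2).trans ?_)
    rw [add_mul]
    gcongr

end Picard

/-! ### Equations whose linearization has finite-dimensional kernel -/

section Reduction

variable {F : Type u} [AddCommGroup F] [Module ℝ F] [MetricSpace F] [FrechetSpace F]
  {G : Type u} [NormedAddCommGroup G] [NormedSpace ℝ G]
  {N : Type} [NormedAddCommGroup N] [NormedSpace ℝ N]

/-- The map `σ` has on `V` the derivative `1 + R x - s π`, where `s π` factors through the
(finite-dimensional) space `N`, where `R x` maps the Banach space `BS q` to `F` and depends on `x`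
in a `K` times differentiable way, and where `1 + R x` is invertible on `BS q`. -/
structure IsReduction (K : ℕ) (V : Set F) (q : CSem F) (s : N →L[ℝ] F) (π : BS q →L[ℝ] N)
    (R : F → BS q →L[ℝ] F) (σ : F → F) : Prop where
  continuousOn : ContinuousOn σ V
  deriv : ∀ x ∈ V, ∀ h : F, Tendsto (fun t : ℝ => t⁻¹ • (σ (x + t • h) - σ x)) (𝓝[≠] 0)
    (𝓝 (h + R x (iota q h) - s (π (iota q h))))
  smooth : ∀ r : CSem F, SC K V fun x => (iota r).comp (R x)
  isUnit : ∀ x ∈ V, IsUnit (1 + (iota q).comp (R x) : BS q →L[ℝ] BS q)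

/-- The frame `(1 + R x)⁻¹ s`. The inverse is taken in `BS q`, and the formula shows that the
values lie in `F`. -/
def frame {q : CSem F} (s : N →L[ℝ] F) (R : F → BS q →L[ℝ] F) (x : F) : N →L[ℝ] F :=
  s - (R x).comp ((Ring.inverse (1 + (iota q).comp (R x))).comp ((iota q).comp s))

namespace IsReduction

variable {K : ℕ} {V : Set F} {q : CSem F} {s : N →L[ℝ] F} {π : BS q →L[ℝ] N}
  {R : F → BS q →L[ℝ] F} {σ : F → F}

theorem iota_frame (h : IsReduction K V q s π R σ) {x : F} (hx : x ∈ V) (η : N) :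
    iota q (frame s R x η) = Ring.inverse (1 + (iota q).comp (R x)) (iota q (s η)) := by
  have h1 := Ring.mul_inverse_cancel _ (h.isUnit x hx)
  have h2 := congrArg (fun L : BS q →L[ℝ] BS q => L (iota q (s η))) h1
  simp only [mul_apply_eq_comp, one_apply_eq_self, _root_.add_apply,
    ContinuousLinearMap.comp_apply] at h2
  simp only [frame, _root_.sub_apply, ContinuousLinearMap.comp_apply, map_sub]
  rw [sub_eq_iff_eq_add]
  exact h2.symm

theorem frame_add (h : IsReduction K V q s π R σ) {x : F} (hx : x ∈ V) (η : N) :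
    frame s R x η + R x (iota q (frame s R x η)) = s η := by
  rw [h.iota_frame hx]
  simp [frame]

theorem smooth_inverse (h : IsReduction K V q s π R σ) :
    SC K V fun x => Ring.inverse (1 + (iota q).comp (R x)) := by
  refine (h.smooth q).contDiffAt_comp (Φ := fun L : BS q →L[ℝ] BS q => Ring.inverse (1 + L))
    fun x hx => ?_
  have h1 : ContDiffAt ℝ K Ring.inverse (1 + (iota q).comp (R x)) := by
    obtain ⟨u, hu⟩ := h.isUnit x hx
    rw [← hu]
    exact contDiffAt_ringInverse ℝ u
  exact h1.comp ((iota q).comp (R x)) (contDiffAt_const.add contDiffAt_id)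

theorem smooth_frame (h : IsReduction K V q s π R σ) (r : CSem F) :
    SC K V fun x => (iota r).comp (frame s R x) := by
  have h1 := (h.smooth r).prodMk h.smooth_inverse
  have h2 := h1.contDiff_comp (Φ := fun z => (iota r).comp s -
    z.1.comp (z.2.comp ((iota q).comp s)))
    (contDiff_const.sub (contDiff_fst.clm_comp (contDiff_snd.clm_comp contDiff_const)))
  have e : (fun x => (iota r).comp (frame s R x)) = fun x => (iota r).comp s -
      ((iota r).comp (R x)).comp ((Ring.inverse (1 + (iota q).comp (R x))).comp
        ((iota q).comp s)) := by
    funext x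
    ext η
    simp [frame]
  rw [e]
  exact h2

/-- The map `Ψ = σ + s π`, with derivative `1 + R x`. -/
theorem tendsto_add (h : IsReduction K V q s π R σ) {x : F} (hx : x ∈ V) (v : F) :
    Tendsto (fun t : ℝ => t⁻¹ • ((σ (x + t • v) + s (π (iota q (x + t • v)))) -
      (σ x + s (π (iota q x))))) (𝓝[≠] 0) (𝓝 (v + R x (iota q v))) := by
  have h1 := (h.deriv x hx v).add_const (s (π (iota q v)))
  rw [sub_add_cancel] at h1
  refine h1.congr' ?_
  filter_upwards [self_mem_nhdsWithin] with t ht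
  have e : s (π (iota q (x + t • v))) = s (π (iota q x)) + t • s (π (iota q v)) := by simp
  have e' : t⁻¹ • t • s (π (iota q v)) = s (π (iota q v)) := inv_smul_smul₀ ht _
  rw [e, add_sub_add_comm, add_sub_cancel_left, smul_add, e']

theorem hasBD_sub_id (h : IsReduction K V q s π R σ) (r : CSem F) :
    HasBD V (fun x => iota r (σ x + s (π (iota q x)) - x)) q fun x => (iota r).comp (R x) := by
  intro x hx v
  have h1 := (h.tendsto_add hx v).sub_const v
  rw [add_sub_cancel_left] at h1
  refine (((iota r).continuous.tendsto _).comp h1).congr' ?_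
  filter_upwards [self_mem_nhdsWithin] with t ht
  have e' : t⁻¹ • t • v = v := inv_smul_smul₀ ht _
  rw [Function.comp_apply, ← map_sub, ← map_smul]
  congr 1
  rw [sub_eq_iff_eq_add]
  calc _ = t⁻¹ • ((σ (x + t • v) + s (π (iota q (x + t • v))) - (x + t • v) -
        (σ x + s (π (iota q x)) - x)) + t • v) := by
        congr 1
        abel
    _ = _ := by rw [smul_add, e']

theorem hasBD_add (h : IsReduction K V q s π R σ) (r : CSem F) :
    HasBD V (fun x => iota r (σ x + s (π (iota q x)))) (q ⊔ r) fun x =>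
      res le_sup_right + ((iota r).comp (R x)).comp (res le_sup_left) := by
  intro x hx v
  have h1 := ((iota r).continuous.tendsto _).comp (h.tendsto_add hx v)
  have e : (res le_sup_right + ((iota r).comp (R x)).comp (res le_sup_left) :
      BS (q ⊔ r) →L[ℝ] BS r) (iota (q ⊔ r) v) = iota r (v + R x (iota q v)) := by simp
  rw [e]
  refine h1.congr fun t => ?_
  rw [Function.comp_apply, map_smul, map_sub]

/-- Differences of points are controlled by the differences of their images under `Ψ`. -/
theorem sub_le (h : IsReduction K V q s π R σ) (hV : IsOpen V) {x₀ : F} (hx₀ : x₀ ∈ V)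
    (r : CSem F) :
    ∃ C ≥ 0, ∃ O ∈ 𝓝 x₀, ∀ x ∈ O, ∀ y ∈ O, r (y - x) ≤
      C * q ((σ y + s (π (iota q y))) - (σ x + s (π (iota q x)))) +
        r ((σ y + s (π (iota q y))) - (σ x + s (π (iota q x)))) := by
  set J : BS q →L[ℝ] BS q := Ring.inverse (1 + (iota q).comp (R x₀)) with hJ
  have hJ1 := Ring.inverse_mul_cancel _ (h.isUnit x₀ hx₀)
  rw [← hJ] at hJ1
  obtain ⟨ε, hε, -, H⟩ := (h.hasBD_sub_id q).strict hV (h.smooth q).continuousOn hx₀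
    (ε := 1 / (2 * (‖J‖ + 1))) (by positivity)
  obtain ⟨C, hC, δ, hδ, -, H'⟩ := (h.hasBD_sub_id r).lip hV (h.smooth r).continuousOn hx₀
  refine ⟨C * (2 * ‖J‖), by positivity, _,
    inter_mem (Metric.ball_mem_nhds x₀ hε) (Metric.ball_mem_nhds x₀ hδ), ?_⟩
  rintro x ⟨hx, hx'⟩ y ⟨hy, hy'⟩
  have h1 := H x hx y hy
  have h2 := H' x hx' y hy'
  rw [← map_sub, norm_iota] at h2
  rw [← map_sub] at h1
  set ψx := σ x + s (π (iota q x))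
  set ψy := σ y + s (π (iota q y))
  have e : ψy - y - (ψx - x) = (ψy - ψx) - (y - x) := by abel
  rw [e] at h1 h2
  have h3 : q (y - x) ≤ 2 * ‖J‖ * q (ψy - ψx) := by
    have e2 : J (iota q (ψy - ψx)) - iota q (y - x) =
        J (iota q (ψy - ψx - (y - x)) - ((iota q).comp (R x₀)) (iota q (y - x))) := by
      have h4 := congrArg (fun L : BS q →L[ℝ] BS q => L (iota q (y - x))) hJ1
      simp only [mul_apply_eq_comp, one_apply_eq_self,
        _root_.add_apply, map_add] at h4
      rw [map_sub (iota q) (ψy - ψx) (y - x), map_sub J, map_sub J, sub_sub, h4]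
    have h5 := J.le_opNorm (iota q (ψy - ψx))
    have h6 := (J.le_opNorm _).trans (mul_le_mul_of_nonneg_left h1 (norm_nonneg J))
    rw [← e2] at h6
    have h7 : ‖J‖ * (1 / (2 * (‖J‖ + 1)) * q (y - x)) ≤ 1 / 2 * q (y - x) := by
      rw [← mul_assoc]
      refine mul_le_mul_of_nonneg_right ?_ (q.nonneg _)
      rw [mul_one_div, div_le_div_iff₀ (by positivity) (by positivity)]
      nlinarith [norm_nonneg J]
    have h8 := norm_sub_norm_le (iota q (y - x)) (J (iota q (ψy - ψx)))
    rw [norm_sub_rev, norm_iota] at h8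
    rw [norm_iota] at h5
    linarith
  have h4 : r (y - x) ≤ r (ψy - ψx) + r ((ψy - ψx) - (y - x)) := by
    have := r.sub_le (ψy - ψx) ((ψy - ψx) - (y - x))
    rwa [sub_sub_cancel] at this
  have h5 := mul_le_mul_of_nonneg_left h3 hC
  nlinarith

/-- Near a point, `f` is Hölder continuous of exponent `k + 1`, with respect to the coordinate
`π`, on the set of zeros of `σ` at which `f` is flat to order `k`. -/
theorem flat_holder (h : IsReduction K V q s π R σ) (hV : IsOpen V) {x₀ : F} (hx₀ : x₀ ∈ V)
    {k : ℕ} (hk : k + 2 ≤ K) {f : F → G} (hf : SC (k + 2) V f) :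
    ∃ C ≥ 0, ∃ O ∈ 𝓝 x₀, ∀ x ∈ O, ∀ y ∈ O, σ x = 0 → σ y = 0 → Flat (frame s R) k f x →
      ‖f y - f x‖ ≤ C * ‖π (iota q (y - x))‖ ^ (k + 1) := by
  have hv : ∀ r : CSem F, SC K V fun x => (iota r).comp (frame s R x) := h.smooth_frame
  have hv1 : ∀ r : CSem F, SC 1 V fun x => (iota r).comp (frame s R x) :=
    fun r => (hv r).of_le (by omega)
  -- The map `Ψ = σ + s π` has the derivative `s` along the frame. Hence it moves along the Picard
  -- iterates with direction `η` by `s η`, up to errors of order `k + 1`.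
  obtain ⟨r, Cf, hCf, ε, hε, -, hlip⟩ := (hf.of_le (k := 1) (by omega)).lip hV hx₀
  obtain ⟨C₁, hC₁, h₁⟩ := Flat.picard_le hV hx₀ k k le_rfl
    (fun r => (hv r).of_le (by omega)) hf
  have hΨ : ∀ r : CSem F, ∃ C ≥ 0, ∀ᶠ z in 𝓝 x₀ ×ˢ 𝓝 (0 : N), ∀ M : ℕ, 0 < M →
      (M : ℝ)⁻¹ ≤ ‖z.2‖ ^ k →
      r ((σ (picard (frame s R) M z.1 z.2 (k + 1) M) +
        s (π (iota q (picard (frame s R) M z.1 z.2 (k + 1) M)))) -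
        (σ z.1 + s (π (iota q z.1))) - s z.2) ≤ C * ‖z.2‖ ^ (k + 1) := by
    intro r
    have hS : SC 1 V fun x => (res (le_sup_right : r ≤ q ⊔ r) +
        ((iota r).comp (R x)).comp (res le_sup_left)) :=
      (SC.const 1 V _).add (((h.smooth r).of_le (by omega)).clm
        ((ContinuousLinearMap.compL ℝ (BS (q ⊔ r)) (BS q) (BS r)).flip (res le_sup_left)))
    obtain ⟨C, hC, H⟩ := picard_sum_le hV hx₀ hv1 k (h.hasBD_add r) hS
    refine ⟨C, hC, ?_⟩
    filter_upwards [H, picard_mem hV hx₀ hv1 (k + 1) (hV.mem_nhds hx₀)] with z hz hzV M hM hMk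
    have h2 := hz M hMk M le_rfl
    have e : ∀ j ∈ Finset.range M, (res le_sup_right +
        ((iota r).comp (R (picard (frame s R) M z.1 z.2 (k + 1) j))).comp (res le_sup_left) :
          BS (q ⊔ r) →L[ℝ] BS r)
        (iota (q ⊔ r) (frame s R (picard (frame s R) M z.1 z.2 (k + 1) j) z.2)) =
        iota r (s z.2) := by
      intro j hj
      have hj' := hzV M j (Finset.mem_range.1 hj).le
      rw [← h.frame_add hj' z.2]
      simp
    rw [Finset.sum_congr rfl e, Finset.sum_const, Finset.card_range, ← Nat.cast_smul_eq_nsmul ℝ,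
      inv_smul_smul₀ (by exact_mod_cast hM.ne'), ← map_sub, ← map_sub, norm_iota] at h2
    exact h2
  obtain ⟨C₂, hC₂, h₂⟩ := hΨ q
  obtain ⟨C₃, hC₃, h₃⟩ := hΨ r
  obtain ⟨C₄, hC₄, O, hO, h₄⟩ := h.sub_le hV hx₀ r
  have hη : Tendsto (fun p : F × F => (p.1, π (iota q (p.2 - p.1)))) (𝓝 x₀ ×ˢ 𝓝 x₀)
      (𝓝 x₀ ×ˢ 𝓝 (0 : N)) := by
    refine tendsto_fst.prodMk ?_
    have hc : Continuous fun p : F × F => π (iota q (p.2 - p.1)) := by fun_prop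
    have := hc.tendsto (x₀, x₀)
    simpa [nhds_prod_eq] using this
  have hO' := inter_mem hO (Metric.ball_mem_nhds x₀ hε)
  obtain ⟨O₁, hO₁, H⟩ := Filter.eventually_prod_self_iff'.1
    (hη.eventually ((h₁.and (h₂.and h₃)).and (picard_mem hV hx₀ hv1 (k + 1) hO')))
  refine ⟨C₁ + Cf * (C₄ * C₂ + C₃), by positivity, _, inter_mem hO₁ hO', ?_⟩
  rintro x ⟨hx1, hxO, hxε⟩ y ⟨hy1, hyO, hyε⟩ hσx hσy hflat
  obtain ⟨⟨H1, H2, H3⟩, H4⟩ := H x hx1 y hy1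
  simp only at H1 H2 H3 H4
  set η := π (iota q (y - x)) with hηdef
  have hΔ : (σ y + s (π (iota q y))) - (σ x + s (π (iota q x))) = s η := by
    rw [hσx, hσy, zero_add, zero_add, hηdef, map_sub, map_sub, map_sub]
  -- The endpoint of the iterates that start at `x` in the direction `η = π (y - x)` has nearly the
  -- same image under `Ψ` as `y`, so that it is close to `y`. If `η = 0`, the error bounds may
  -- fail for every number of time steps, but then `Ψ x = Ψ y`.
  rcases eq_or_ne η 0 with h0 | h0
  · have h5 := h₄ x hxO y hyO
    rw [hΔ, h0, map_zero, CSem.map_zero, CSem.map_zero, mul_zero, add_zero] at h5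
    have h6 := (hlip x hxε y hyε).trans (mul_le_mul_of_nonneg_left h5 hCf)
    rw [mul_zero] at h6
    refine h6.trans (by positivity)
  · have hpos : 0 < ‖η‖ ^ k := pow_pos (norm_pos_iff.2 h0) k
    obtain ⟨M, hM⟩ := exists_nat_gt (‖η‖ ^ k)⁻¹
    have hM0 : (0 : ℝ) < M := (inv_pos.2 hpos).trans hM
    have hM' : (M : ℝ)⁻¹ ≤ ‖η‖ ^ k := (inv_lt_of_inv_lt₀ hpos hM).le
    have hMN : 0 < M := by exact_mod_cast hM0
    have a1 := H1 hflat M hM' M le_rfl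
    have a2 := H2 M hMN hM'
    have a3 := H3 M hMN hM'
    obtain ⟨hcO, hcε⟩ := H4 M M le_rfl
    set c := picard (frame s R) M x η (k + 1) M
    have e : (σ c + s (π (iota q c))) - (σ x + s (π (iota q x))) - s η =
        (σ c + s (π (iota q c))) - (σ y + s (π (iota q y))) := by
      rw [← hΔ]
      abel
    rw [e] at a2 a3
    have a4 := h₄ y hyO c hcO
    have a5 := (hlip y hyε c hcε).trans (mul_le_mul_of_nonneg_left a4 hCf)
    have a6 : ‖f c - f y‖ ≤ Cf * ((C₄ * C₂ + C₃) * ‖η‖ ^ (k + 1)) := by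
      refine a5.trans (mul_le_mul_of_nonneg_left ?_ hCf)
      have := mul_le_mul_of_nonneg_left a2 hC₄
      linarith
    have a7 : ‖f y - f x‖ ≤ ‖f c - f x‖ + ‖f c - f y‖ := by
      have : f y - f x = (f c - f x) - (f c - f y) := by abel
      rw [this]
      exact norm_sub_le _ _
    linarith

end IsReduction
end Reduction

/-! ### Sard's theorem on the zero set of such an equation -/

section Sard

open MeasureTheory Module

/-- If `g` is Hölder continuous of exponent `n + 1` with respect to a map to a space of dimension at
most `n`, then its image has Hausdorff dimension less than one. -/
theorem volume_image_eq_zero_of_holder {X N : Type*} [NormedAddCommGroup N] [NormedSpace ℝ N]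
    [FiniteDimensional ℝ N] {n : ℕ} (hn : finrank ℝ N ≤ n) {S : Set X} {φ : X → N} {g : X → ℝ}
    {C : ℝ} (hC : 0 ≤ C)
    (h : ∀ x ∈ S, ∀ y ∈ S, dist (g x) (g y) ≤ C * dist (φ x) (φ y) ^ (n + 1)) :
    volume (g '' S) = 0 := by
  rcases S.eq_empty_or_nonempty with rfl | ⟨x₀, hx₀⟩
  · simp
  have : Nonempty X := ⟨x₀⟩
  -- The map `g` factors through `φ` on `S`, since `n + 1 > 0`.
  have hinv : ∀ x ∈ S, Function.invFunOn φ S (φ x) ∈ S ∧ φ (Function.invFunOn φ S (φ x)) = φ x :=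
    fun x hx => ⟨Function.invFunOn_mem ⟨x, hx, rfl⟩, Function.invFunOn_eq ⟨x, hx, rfl⟩⟩
  have himg : g '' S = (g ∘ Function.invFunOn φ S) '' (φ '' S) := by
    rw [image_image]
    refine image_congr fun x hx => ?_
    obtain ⟨h1, h2⟩ := hinv x hx
    have h3 := h x hx _ h1
    rw [h2, dist_self, zero_pow (by omega), mul_zero] at h3
    exact dist_le_zero.1 h3
  have hH : HolderOnWith ⟨C, hC⟩ (n + 1 : ℕ) (g ∘ Function.invFunOn φ S) (φ '' S) := by
    rintro _ ⟨x, hx, rfl⟩ _ ⟨y, hy, rfl⟩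
    obtain ⟨h1, h2⟩ := hinv x hx
    obtain ⟨h3, h4⟩ := hinv y hy
    have h5 := h _ h1 _ h3
    rw [h2, h4] at h5
    rw [edist_dist, edist_dist, Function.comp_apply, Function.comp_apply]
    refine (ENNReal.ofReal_le_ofReal h5).trans (le_of_eq ?_)
    rw [ENNReal.ofReal_mul hC, ENNReal.ofReal_pow dist_nonneg, NNReal.coe_natCast,
      ENNReal.rpow_natCast]
    congr 1
    exact ENNReal.ofReal_eq_coe_nnreal hC
  have hd := hH.dimH_image_le (by positivity)
  have hd1 : dimH (φ '' S) ≤ n := by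
    refine (dimH_mono (subset_univ _)).trans ?_
    rw [Real.dimH_univ_eq_finrank]
    exact_mod_cast hn
  have hd2 : dimH ((g ∘ Function.invFunOn φ S) '' (φ '' S)) < (1 : NNReal) := by
    refine (hd.trans (ENNReal.div_le_div_right hd1 _)).trans_lt ?_
    rw [ENNReal.div_lt_iff (Or.inl (by simp)) (Or.inl (by simp))]
    simp only [ENNReal.coe_one, one_mul]
    push_cast
    exact_mod_cast Nat.lt_succ_self n
  rw [himg]
  have := hausdorffMeasure_of_dimH_lt hd2
  rwa [NNReal.coe_one, hausdorffMeasure_real] at this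

theorem volume_image_eq_zero_of_locally {X : Type*} [TopologicalSpace X]
    [SecondCountableTopology X] {g : X → ℝ} {A : Set X}
    (h : ∀ x ∈ A, ∃ O ∈ 𝓝 x, volume (g '' (O ∩ A)) = 0) : volume (g '' A) = 0 := by
  choose! O hO hO' using h
  obtain ⟨t, htA, htc, ht⟩ :=
    TopologicalSpace.countable_cover_nhdsWithin fun x hx => mem_nhdsWithin_of_mem_nhds (hO x hx)
  refine measure_mono_null (t := ⋃ x ∈ t, g '' (O x ∩ A)) ?_
    ((measure_biUnion_null_iff htc).2 fun x hx => hO' x (htA hx))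
  rintro _ ⟨x, hx, rfl⟩
  obtain ⟨y, hy, hxy⟩ := mem_iUnion₂.1 (ht hx)
  exact mem_iUnion₂.2 ⟨y, hy, x, ⟨hxy, hx⟩, rfl⟩

variable {F : Type u} [AddCommGroup F] [Module ℝ F] [MetricSpace F] [FrechetSpace F]
  {G : Type u} [NormedAddCommGroup G] [NormedSpace ℝ G]
  {N : Type} [NormedAddCommGroup N] [NormedSpace ℝ N]

/-- If `1 + ρ S` is invertible, then so is `1 + S ρ`, with the inverse `1 - S (1 + ρ S)⁻¹ ρ`. -/
theorem isUnit_one_add_comp_swap {E E' : Type*} [NormedAddCommGroup E] [NormedSpace ℝ E]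
    [NormedAddCommGroup E'] [NormedSpace ℝ E'] {S : E →L[ℝ] E'} {ρ : E' →L[ℝ] E}
    (h : IsUnit (1 + ρ.comp S)) : IsUnit (1 + S.comp ρ) := by
  obtain ⟨J, hJ1, hJ2⟩ := isUnit_iff_exists.1 h
  refine isUnit_iff_exists.2 ⟨1 - S.comp (J.comp ρ), ?_, ?_⟩
  · ext y
    have h1 := congrArg (fun L : E →L[ℝ] E => S (L (ρ y))) hJ1
    simp only [mul_apply_eq_comp, one_apply_eq_self, _root_.add_apply, _root_.sub_apply,
      ContinuousLinearMap.comp_apply, map_add, map_sub] at h1 ⊢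
    rw [← h1]
    abel
  · ext y
    have h1 := congrArg (fun L : E →L[ℝ] E => S (L (ρ y))) hJ2
    simp only [mul_apply_eq_comp, one_apply_eq_self, _root_.add_apply, _root_.sub_apply,
      ContinuousLinearMap.comp_apply, map_add] at h1 ⊢
    have h2 : S (ρ y) - S (J (ρ (S (ρ y)))) = S (J (ρ y)) := by
      rw [sub_eq_iff_eq_add]
      exact h1.symm
    rw [h2, sub_add_cancel]

/-- An equation `w = 0` whose derivative does not vanish along the frame can be added to the
equation `σ = 0`; the dimension of the space through which the finite rank part factors decreases
by one. The new map is `σ' = σ + (l w - λ σ) s e`, where `e` is a vector in the direction of which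
`w` varies, and the functionals `l` and `λ` are chosen such that `σ'` has at `x₁` the derivative
`1 + R x₁ - s p π` with a projection `p` along `e`. -/
theorem IsReduction.add_equation [FiniteDimensional ℝ N] {K m n : ℕ} {V : Set F} {q : CSem F}
    {s : N →L[ℝ] F} {π : BS q →L[ℝ] N} {R : F → BS q →L[ℝ] F} {σ : F → F}
    (h : IsReduction K V q s π R σ) (hV : IsOpen V) (hm : m ≤ K) (hn : finrank ℝ N ≤ n + 1)
    {w : F → G} (hw : SC (m + 1) V w) {x₁ : F} (hx₁ : x₁ ∈ V)
    (hne : plus (frame s R) w x₁ ≠ 0) :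
    ∃ (N' : Submodule ℝ N) (V' : Set F) (q' : CSem F) (s' : N' →L[ℝ] F) (π' : BS q' →L[ℝ] N')
      (R' : F → BS q' →L[ℝ] F) (σ' : F → F), finrank ℝ N' ≤ n ∧ IsOpen V' ∧ V' ⊆ V ∧ x₁ ∈ V' ∧
      IsReduction m V' q' s' π' R' σ' ∧ ∀ x, σ x = 0 → w x = 0 → σ' x = 0 := by
  obtain ⟨e, he⟩ : ∃ e, plus (frame s R) w x₁ e ≠ 0 := by
    by_contra! hcon
    exact hne (ContinuousLinearMap.ext hcon)
  obtain ⟨l, hl⟩ := SeparatingDual.exists_eq_one (R := ℝ) he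
  obtain ⟨hwc, qw, B, hB, hBS⟩ := hw
  rw [hB.plus_eq hx₁] at hl
  let qn : CSem F := q ⊔ qw
  let ρ : BS qn →L[ℝ] BS q := res le_sup_left
  let ρw : BS qn →L[ℝ] BS qw := res le_sup_right
  have hρ : ∀ x, ρ (iota qn x) = iota q x := res_iota _
  have hρw : ∀ x, ρw (iota qn x) = iota qw x := res_iota _
  let A : F → BS qn →L[ℝ] BS qn := fun x => ((iota qn).comp (R x)).comp ρ
  have hA : ∀ x ∈ V, IsUnit (1 + A x) := fun x hx => by
    refine isUnit_one_add_comp_swap ?_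
    have e1 : ρ.comp ((iota qn).comp (R x)) = (iota q).comp (R x) := by
      ext y
      simp [hρ]
    rw [e1]
    exact h.isUnit x hx
  set J : BS qn →L[ℝ] BS qn := Ring.inverse (1 + A x₁) with hJ
  have hJ1 : J * (1 + A x₁) = 1 := Ring.inverse_mul_cancel _ (hA x₁ hx₁)
  -- This choice makes the correction `κ` of the derivative vanish at `x₁`.
  let lam : BS qn →L[ℝ] ℝ := (l.comp ((B x₁).comp ρw)).comp J
  have hlam : lam.comp (1 + A x₁) = l.comp ((B x₁).comp ρw) := by
    change ((l.comp ((B x₁).comp ρw)).comp J).comp (1 + A x₁) = _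
    rw [ContinuousLinearMap.comp_assoc]
    change (l.comp ((B x₁).comp ρw)).comp (J * (1 + A x₁)) = _
    rw [hJ1]
    rfl
  have hlam1 : lam (iota qn (s e)) = 1 := by
    have h1 : iota qn (s e) = (1 + A x₁) (iota qn (frame s R x₁ e)) := by
      rw [← h.frame_add hx₁ e]
      simp [A, hρ]
    rw [h1, ← ContinuousLinearMap.comp_apply, hlam]
    simpa [hρw] using hl
  let κ : F → BS qn →L[ℝ] ℝ := fun x => l.comp ((B x).comp ρw) - lam.comp (1 + A x)
  have hκ : κ x₁ = 0 := by
    simp only [κ]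
    rw [hlam, sub_self]
  have hAS : SC m V A := ((h.smooth qn).of_le hm).clm
    ((ContinuousLinearMap.compL ℝ (BS qn) (BS q) (BS qn)).flip ρ)
  let R' : F → BS qn →L[ℝ] F := fun x => (R x).comp ρ + (κ x).smulRight (s e)
  have hRS : ∀ r : CSem F, SC m V fun x => (iota r).comp (R' x) := by
    intro r
    have h1 : SC m V fun x => ((iota r).comp (R x)).comp ρ := ((h.smooth r).of_le hm).clm
      ((ContinuousLinearMap.compL ℝ (BS qn) (BS q) (BS r)).flip ρ)
    have h2 := (hBS.prodMk hAS).contDiff_comp (G' := BS qn →L[ℝ] BS r)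
      (Φ := fun z => (l.comp (z.1.comp ρw) - lam.comp (1 + z.2)).smulRight (iota r (s e))) (by
        have h3 : ContDiff ℝ m fun z : (BS qw →L[ℝ] G) × (BS qn →L[ℝ] BS qn) =>
            l.comp (z.1.comp ρw) - lam.comp (1 + z.2) :=
          (contDiff_const.clm_comp (contDiff_fst.clm_comp contDiff_const)).sub
            (contDiff_const.clm_comp (contDiff_const.add contDiff_snd))
        exact (((ContinuousLinearMap.smulRightL ℝ (BS qn) (BS r)).flip
          (iota r (s e))).contDiff).comp h3)
    refine (h1.add h2).congr hV fun x _ => ?_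
    ext y
    simp [R', κ]
  let μ : N →L[ℝ] ℝ := lam.comp ((iota qn).comp s)
  have hμ : μ e = 1 := hlam1
  let N' : Submodule ℝ N := LinearMap.ker μ.toLinearMap
  let p : N →L[ℝ] N' := (ContinuousLinearMap.id ℝ N - μ.smulRight e).codRestrict N' fun y => by
    simp [N', hμ]
  have hfin : finrank ℝ N' ≤ n := by
    have h1 := LinearMap.finrank_range_add_finrank_ker μ.toLinearMap
    have h2 : LinearMap.range μ.toLinearMap = ⊤ := by
      rw [LinearMap.range_eq_top]
      intro a
      refine ⟨a • e, ?_⟩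
      simp [hμ]
    rw [h2, finrank_top, finrank_self] at h1
    change finrank ℝ (LinearMap.ker μ.toLinearMap) ≤ n
    omega
  have hcont : ContinuousOn (fun x => 1 + (iota qn).comp (R' x)) V :=
    continuousOn_const.add (hRS qn).continuousOn
  let V' : Set F := V ∩ (fun x => 1 + (iota qn).comp (R' x)) ⁻¹' {L | IsUnit L}
  have hV' : IsOpen V' := hcont.isOpen_inter_preimage hV Units.isOpen
  refine ⟨N', V', qn, s.comp N'.subtypeL, p.comp (π.comp ρ), R',
    fun x => σ x + (l (w x) - lam (iota qn (σ x))) • s e, hfin, hV', inter_subset_left,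
    ⟨hx₁, ?_⟩, ⟨?_, ?_, fun r => (hRS r).mono inter_subset_left, fun x hx => hx.2⟩, ?_⟩
  · have e1 : (iota qn).comp (R' x₁) = A x₁ := by
      ext y
      simp [R', hκ, A]
    change IsUnit (1 + (iota qn).comp (R' x₁))
    rw [e1]
    exact hA x₁ hx₁
  · have h1 : ContinuousOn σ V' := h.continuousOn.mono inter_subset_left
    have h2 : ContinuousOn w V' := hwc.mono inter_subset_left
    have h3 : ContinuousOn (fun x => l (w x) - lam (iota qn (σ x))) V' :=
      (l.continuous.comp_continuousOn h2).sub
        (lam.continuous.comp_continuousOn ((iota qn).continuous.comp_continuousOn h1))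
    exact h1.add (h3.smul continuousOn_const)
  · intro x hx v
    have h1 := h.deriv x hx.1 v
    have h2 := (l.continuous.tendsto _).comp (hB x hx.1 v)
    have h3 := ((lam.comp (iota qn)).continuous.tendsto _).comp h1
    have h4 := h1.add ((h2.sub h3).smul_const (s e))
    have e1 : v + R' x (iota qn v) - (s.comp N'.subtypeL) ((p.comp (π.comp ρ)) (iota qn v)) =
        (v + R x (iota q v) - s (π (iota q v))) + (l (B x (iota qw v)) -
          (lam.comp (iota qn)) (v + R x (iota q v) - s (π (iota q v)))) • s e := by
      have e2 : ((p.comp (π.comp ρ)) (iota qn v) : N) =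
          π (iota q v) - lam (iota qn (s (π (iota q v)))) • e := by
        simp [p, hρ, μ]
      have e3 : R' x (iota qn v) = R x (iota q v) +
          (l (B x (iota qw v)) - lam (iota qn v + iota qn (R x (iota q v)))) • s e := by
        simp [R', κ, A, hρ, hρw]
      have e4 : (s.comp N'.subtypeL) ((p.comp (π.comp ρ)) (iota qn v)) =
          s (π (iota q v) - lam (iota qn (s (π (iota q v)))) • e) := congrArg s e2
      rw [e3, e4]
      simp only [ContinuousLinearMap.comp_apply, map_sub, map_add, map_smul]
      module
    rw [e1]
    refine h4.congr fun t => ?_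
    simp only [Function.comp_apply, ContinuousLinearMap.comp_apply, map_smul, map_sub,
      smul_eq_mul]
    module
  · intro x h1 h2
    simp [h1, h2]

/-- All directional derivatives of `f` at `x` vanish. -/
def IsDirCritical {E : Type*} [AddCommGroup E] [Module ℝ E] (f : E → G) (x : E) : Prop :=
  ∀ h : E, Tendsto (fun t : ℝ => t⁻¹ • (f (x + t • h) - f x)) (𝓝[≠] 0) (𝓝 0)

theorem plus_eq_zero_of_isDirCritical {v : F → N →L[ℝ] F} {f : F → G} {x : F}
    (h : IsDirCritical f x) : plus v f x = 0 := by
  have h' : ∃ L : N →L[ℝ] G, ∀ η,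
      Tendsto (fun t : ℝ => t⁻¹ • (f (x + t • v x η) - f x)) (𝓝[≠] 0) (𝓝 (L η)) :=
    ⟨0, fun η => h (v x η)⟩
  rw [plus, dif_pos h']
  exact ContinuousLinearMap.ext fun η => tendsto_nhds_unique (h'.choose_spec η) (h (v x η))

/-- The points of `Z` at which `w` vanishes without being flat to the order `j` have a null set of
`g`-values: at such a point one of the iterated derivatives of `w` vanishes and the next one does
not, and `H` says that points of this kind contribute null sets locally. -/
theorem volume_image_eq_zero_of_not_flat [SecondCountableTopology F] {V : Set F} (hV : IsOpen V)
    {v : F → N →L[ℝ] F} {g : F → ℝ} {Z : Set F} {m : ℕ}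
    (H : ∀ {G : Type u} [NormedAddCommGroup G] [NormedSpace ℝ G] (w : F → G), SC (m + 1) V w →
      ∀ x₁ ∈ Z, plus v w x₁ ≠ 0 → ∃ O ∈ 𝓝 x₁, volume (g '' {x ∈ O ∩ Z | w x = 0}) = 0)
    (j : ℕ) (hv : ∀ q : CSem F, SC (m + 1 + j) V fun x => (iota q).comp (v x))
    {w : F → G} (hw : SC (m + 1 + j) V w) {A : Set F} (hA : A ⊆ Z)
    (hwA : ∀ x ∈ A, w x = 0 ∧ ¬ Flat v j w x) : volume (g '' A) = 0 := by
  induction j generalizing G A with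
  | zero =>
    have : A = ∅ := eq_empty_of_forall_notMem fun x hx => (hwA x hx).2 trivial
    simp [this]
  | succ j ih =>
    have h1 : volume (g '' {x ∈ A | plus v w x ≠ 0}) = 0 := by
      refine volume_image_eq_zero_of_locally fun x hx => ?_
      obtain ⟨O, hO, hO'⟩ := H w (hw.of_le (by omega)) x (hA hx.1) hx.2
      refine ⟨O, hO, measure_mono_null (image_mono ?_) hO'⟩
      rintro y ⟨hy1, hy2, -⟩
      exact ⟨⟨hy1, hA hy2⟩, (hwA y hy2).1⟩
    have h2 : volume (g '' {x ∈ A | plus v w x = 0}) = 0 := by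
      refine ih (fun q => (hv q).of_succ) (SC.plus hV hw fun q => (hv q).of_succ)
        ((sep_subset _ _).trans hA) ?_
      rintro x ⟨hx, hx0⟩
      exact ⟨hx0, fun hf => (hwA x hx).2 ⟨hx0, hf⟩⟩
    refine measure_mono_null ?_ (measure_union_null h1 h2)
    rw [← image_union]
    refine image_mono fun x hx => ?_
    by_cases h : plus v w x = 0
    · exact Or.inr ⟨hx, h⟩
    · exact Or.inl ⟨hx, h⟩

/-- Sard's theorem for the critical points of `f` that are zeros of `σ`, by induction on the
dimension `n`. The order `(n + 2) ^ 2` suffices: in the step from `n` to `n + 1` at most `n + 2`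
derivatives are used up before an equation is added. -/
theorem IsReduction.sard [SecondCountableTopology F] (n : ℕ) {N : Type} [NormedAddCommGroup N]
    [NormedSpace ℝ N] [FiniteDimensional ℝ N] (hn : finrank ℝ N ≤ n) {K : ℕ}
    (hK : (n + 2) ^ 2 ≤ K) {V : Set F} (hV : IsOpen V) {q : CSem F}
    {s : N →L[ℝ] F} {π : BS q →L[ℝ] N} {R : F → BS q →L[ℝ] F} {σ : F → F}
    (h : IsReduction K V q s π R σ) {f : F → ULift.{u} ℝ} (hf : SC K V f) {x₀ : F} (hx₀ : x₀ ∈ V) :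
    ∃ O ∈ 𝓝 x₀, volume ((fun x => (f x).down) '' {x ∈ O | σ x = 0 ∧ IsDirCritical f x}) = 0 := by
  induction n generalizing N K V q x₀ σ with
  | zero =>
    obtain ⟨C, hC, O, hO, H⟩ := h.flat_holder hV hx₀ (k := 0) (by omega) (hf.of_le (by omega))
    refine ⟨O, hO, volume_image_eq_zero_of_holder hn (φ := fun x => π (iota q x)) hC ?_⟩
    rintro x ⟨hx, hσx, -⟩ y ⟨hy, hσy, -⟩
    have := H y hy x hx hσy hσx trivial
    rwa [map_sub, map_sub, ← dist_eq_norm, ← dist_eq_norm] at this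
  | succ n ih =>
    have hK1 : (n + 2) ^ 2 + n + 2 ≤ K := by nlinarith
    obtain ⟨C, hC, O, hO, H⟩ := h.flat_holder hV hx₀ (k := n + 1) (by nlinarith)
      (hf.of_le (by nlinarith))
    refine ⟨O ∩ V, inter_mem hO (hV.mem_nhds hx₀), ?_⟩
    have h1 : volume ((fun x => (f x).down) '' {x | (x ∈ O ∧ σ x = 0) ∧
        Flat (frame s R) (n + 1) f x}) = 0 := by
      refine volume_image_eq_zero_of_holder hn (φ := fun x => π (iota q x)) hC ?_
      rintro x ⟨⟨hx, hσx⟩, -⟩ y ⟨⟨hy, hσy⟩, hy'⟩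
      have := H y hy x hx hσy hσx hy'
      rwa [map_sub, map_sub, ← dist_eq_norm, ← dist_eq_norm] at this
    have h2 : volume ((fun x => (f x).down) '' {x | (x ∈ V ∧ σ x = 0 ∧ IsDirCritical f x) ∧
        ¬ Flat (frame s R) (n + 1) f x}) = 0 := by
      refine volume_image_eq_zero_of_not_flat hV (v := frame s R) (m := (n + 2) ^ 2)
        (Z := {x | x ∈ V ∧ σ x = 0 ∧ IsDirCritical f x}) ?_ n
        (fun r => (h.smooth_frame r).of_le (by omega))
        (w := plus (frame s R) f)
        (SC.plus hV (hf.of_le (by omega)) fun r => (h.smooth_frame r).of_le (by omega))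
        (fun x hx => hx.1) ?_
      · intro G _ _ w hw x₁ hx₁ hne
        obtain ⟨N', V', q', s', π', R', σ', hn', hV', hVV', hx', h', hσ'⟩ :=
          h.add_equation hV (m := (n + 2) ^ 2) (by omega) hn hw hx₁.1 hne
        obtain ⟨O', hO', hO''⟩ := ih hn' le_rfl hV' h' ((hf.of_le (by omega)).mono hVV') hx'
        refine ⟨O', hO', measure_mono_null (image_mono ?_) hO''⟩
        rintro x ⟨⟨hx, -, hσx, hcx⟩, hwx⟩
        exact ⟨hx, hσ' x hσx hwx, hcx⟩
      · rintro x ⟨⟨-, -, hcx⟩, hx⟩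
        have h0 := plus_eq_zero_of_isDirCritical (v := frame s R) hcx
        exact ⟨h0, fun hfl => hx ⟨h0, hfl⟩⟩
    refine measure_mono_null ?_ (measure_union_null h1 h2)
    rw [← image_union]
    refine image_mono ?_
    rintro x ⟨⟨hxO, hxV⟩, hσx, hcx⟩
    by_cases hx : Flat (frame s R) (n + 1) f x
    · exact Or.inl ⟨⟨hxO, hσx⟩, hx⟩
    · exact Or.inr ⟨⟨hxV, hσx, hcx⟩, hx⟩

end Sard

/-! ### Maps of class `MC^k` have derivatives bounded by seminorms -/

section Front

variable {F : Type u} [AddCommGroup F] [Module ℝ F] [MetricSpace F] [FrechetSpace F]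
  {H : Type u} [AddCommGroup H] [Module ℝ H] [MetricSpace H] [StandardMetric H]
  {G : Type u} [NormedAddCommGroup G] [NormedSpace ℝ G]

/-- Continuity of a linear map at zero suffices. A standard metric need not make scalar
multiplication continuous, so that the criteria for topological vector spaces do not apply. -/
theorem continuous_of_standard {H' : Type*} [AddCommGroup H'] [Module ℝ H'] [MetricSpace H']
    [StandardMetric H'] {H : Type*} [AddCommGroup H] [Module ℝ H] [MetricSpace H]
    [StandardMetric H] (A : H' →ₗ[ℝ] H)
    (h : ∀ ε > 0, ∃ δ > 0, ∀ x, dist x 0 < δ → dist (A x) 0 ≤ ε) : Continuous A := by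
  rw [Metric.continuous_iff]
  intro b ε hε
  obtain ⟨δ, hδ, h⟩ := h (ε / 2) (by positivity)
  refine ⟨δ, hδ, fun a ha => ?_⟩
  rw [← dist_sub_zero] at ha ⊢
  rw [← map_sub]
  linarith [h _ ha]

theorem LipMap.continuous {E : Type*} [AddCommGroup E] [Module ℝ E] [MetricSpace E]
    [StandardMetric E] {H : Type*} [AddCommGroup H] [Module ℝ H] [MetricSpace H]
    [StandardMetric H] (L : LipMap E H) : Continuous L := by
  refine continuous_of_standard L.toLin fun ε hε => ⟨ε / (L.lip + 1), ?_, fun x hx => ?_⟩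
  · have := L.lip_nonneg
    positivity
  · have h0 := L.lip_nonneg
    rw [lt_div_iff₀ (by positivity)] at hx
    have h1 := L.le_lip x
    have h2 : 0 ≤ dist x 0 := dist_nonneg
    nlinarith

theorem StandardMetric.of_norm : StandardMetric G := by
  refine StandardMetric.of_le (fun x y z => dist_add_right _ _ _) (fun a x ha => ?_) ?_
  · rw [dist_zero_right, dist_zero_right, norm_smul]
    exact mul_le_of_le_one_left (norm_nonneg x) ha
  · intro a b x y ha hb hab
    rw [dist_zero_right, dist_zero_right, dist_zero_right]
    have h1 := le_max_left ‖x‖ ‖y‖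
    have h2 := le_max_right ‖x‖ ‖y‖
    calc ‖a • x + b • y‖ ≤ ‖a • x‖ + ‖b • y‖ := norm_add_le _ _
      _ = a * ‖x‖ + b * ‖y‖ := by
        rw [norm_smul, norm_smul, Real.norm_of_nonneg ha, Real.norm_of_nonneg hb]
      _ ≤ a * max ‖x‖ ‖y‖ + b * max ‖x‖ ‖y‖ := by gcongr
      _ = max ‖x‖ ‖y‖ := by rw [← add_mul, hab, one_mul]

/-- The Minkowski functional of the unit ball. Linear maps in the zero component are bounded by
multiples of it after composition with a continuous linear map to a normed space. -/
abbrev unitSem (F : Type u) [AddCommGroup F] [Module ℝ F] [MetricSpace F] [FrechetSpace F] :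
    CSem F := CSem.gaugeBall F 1 one_pos

theorem CSem.norm_le_mul_of_lt_one {q : CSem F} (A : F →ₗ[ℝ] G) {ε : ℝ}
    (h : ∀ x, q x < 1 → ‖A x‖ ≤ ε) (x : F) : ‖A x‖ ≤ ε * q x := by
  have key : ∀ c > q x, ‖A x‖ ≤ ε * c := fun c hc => by
    have hc0 : 0 < c := (q.nonneg x).trans_lt hc
    have h1 := h (c⁻¹ • x) (by
      rw [CSem.smul, abs_of_pos (by positivity), inv_mul_lt_one₀ hc0]
      exact hc)
    rw [map_smul, norm_smul, Real.norm_of_nonneg (by positivity), inv_mul_le_iff₀ hc0] at h1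
    linarith
  have ht : Tendsto (fun c => ε * c) (𝓝[>] q x) (𝓝 (ε * q x)) :=
    (continuous_const_mul ε).continuousAt.continuousWithinAt
  exact ge_of_tendsto ht (eventually_nhdsWithin_of_forall key)

/-- Linear maps with a small Lipschitz constant are small on the unit ball, where they are compared
with the seminorm of this ball by homogeneity. -/
theorem LipMap.exists_bound (Λ : H →L[ℝ] G) {ε : ℝ} (hε : 0 < ε) :
    ∃ δ > 0, ∀ L : LipMap F H, dist L 0 < δ → ∀ x, ‖Λ (L x)‖ ≤ ε * unitSem F x := by
  obtain ⟨δ, hδ, h⟩ := Metric.continuousAt_iff.1 (Λ.continuous.continuousAt (x := 0)) ε hε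
  refine ⟨δ, hδ, fun L hL => ?_⟩
  refine CSem.norm_le_mul_of_lt_one (Λ.toLinearMap ∘ₗ L.toLin) fun x hx => ?_
  have h1 := CSem.dist_lt_of_gaugeBall_lt_one one_pos hx
  rw [LipMap.dist_zero] at hL
  have h2 := L.le_lip x
  have h3 := L.lip_nonneg
  have h4 := h (x := L x) (by nlinarith)
  rw [map_zero, dist_zero_right] at h4
  exact h4.le

/-- The operators that are bounded by the seminorm of the unit ball, after composition with a
continuous linear map to a normed space, form an open and closed set. Hence this set contains the
zero component. -/
theorem LipMapZero.exists_bound (Λ : H →L[ℝ] G) (L : LipMapZero F H) :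
    ∃ C, ∀ x, ‖Λ (L.toLipMap x)‖ ≤ C * unitSem F x := by
  let S : Set (LipMap F H) := {L | ∃ C, ∀ x, ‖Λ (L x)‖ ≤ C * unitSem F x}
  obtain ⟨δ, hδ, h⟩ := LipMap.exists_bound (F := F) Λ one_pos
  have hadd : ∀ L L' : LipMap F H, dist L' L < δ → L ∈ S → L' ∈ S := by
    rintro L L' hd ⟨C, hC⟩
    refine ⟨C + 1, fun x => ?_⟩
    rw [← dist_sub_zero] at hd
    have h1 := h _ hd x
    have h2 : Λ (L' x) = Λ (L x) + Λ ((L' - L) x) := by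
      rw [← map_add]
      exact congrArg Λ (add_sub_cancel (L x) (L' x)).symm
    rw [h2, add_mul]
    exact (norm_add_le _ _).trans (add_le_add (hC x) h1)
  have hS : IsClopen S := by
    constructor
    · rw [← isOpen_compl_iff, Metric.isOpen_iff]
      exact fun L hL => ⟨δ, hδ, fun L' hL' hmem => hL (hadd L' L (by
        rw [dist_comm]
        exact hL') hmem)⟩
    · rw [Metric.isOpen_iff]
      exact fun L hL => ⟨δ, hδ, fun L' hL' => hadd L L' hL' hL⟩
  have h0 : (0 : LipMap F H) ∈ S := ⟨0, fun x => by
    have : (0 : LipMap F H) x = 0 := rfl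
    simp [this]⟩
  exact hS.connectedComponent_subset h0 L.2

/-- Composition with a continuous linear map to a Banach space turns the operators in the zero
component into bounded operators on the completion for the seminorm of the unit ball. -/
theorem LipMapZero.exists_push [CompleteSpace G] (Λ : H →L[ℝ] G) :
    ∃ Λ' : LipMapZero F H →L[ℝ] BS (unitSem F) →L[ℝ] G,
      ∀ L x, Λ' L (iota (unitSem F) x) = Λ (L.toLipMap x) := by
  have hex : ∀ L : LipMapZero F H, ∃ B : BS (unitSem F) →L[ℝ] G,
      ∀ x, B (iota (unitSem F) x) = Λ (L.toLipMap x) := fun L => by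
    obtain ⟨C, hC⟩ := LipMapZero.exists_bound Λ L
    exact exists_lift_of_bound (unitSem F) (Λ.toLinearMap ∘ₗ L.toLipMap.toLin) hC
  choose B hB using hex
  let A : LipMapZero F H →ₗ[ℝ] BS (unitSem F) →L[ℝ] G :=
    { toFun := B
      map_add' := fun L L' => ext_iota fun x => by
        rw [_root_.add_apply, hB, hB, hB, ← map_add]
        rfl
      map_smul' := fun a L => ext_iota fun x => by
        rw [RingHom.id_apply, _root_.smul_apply, hB, hB, ← map_smul]
        rfl }
  have := StandardMetric.of_norm (G := BS (unitSem F) →L[ℝ] G)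
  refine ⟨⟨A, continuous_of_standard A fun ε hε => ?_⟩, hB⟩
  obtain ⟨δ, hδ, h⟩ := LipMap.exists_bound (F := F) Λ hε
  refine ⟨δ, hδ, fun L hL => ?_⟩
  rw [dist_zero_right]
  refine opNorm_le_of_iota hε.le fun x => ?_
  change ‖B L _‖ ≤ _
  rw [hB]
  exact h _ hL x

/-- Near each point, the compositions of an `MC^k` map with all continuous linear maps to Banach
spaces have derivatives bounded by seminorms. The neighbourhood does not depend on the linear map:
it comes from the nested neighbourhoods on which the increments of the successive derivatives lie
in the zero components. -/
theorem MC.exists_SC {k : ℕ} {U : Set F} {P : F → H} (hP : MC.{u, u} k U P) (hU : IsOpen U)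
    {x₀ : F} (hx₀ : x₀ ∈ U) :
    ∃ V : Set F, IsOpen V ∧ x₀ ∈ V ∧ V ⊆ U ∧ ∀ {G : Type u} [NormedAddCommGroup G]
      [NormedSpace ℝ G] [CompleteSpace G] (Λ : H →L[ℝ] G), SC k V fun x => Λ (P x) := by
  induction k generalizing H U with
  | zero => exact ⟨U, hU, hx₀, subset_rfl, fun Λ => Λ.continuous.comp_continuousOn hP⟩
  | succ k ih =>
    obtain ⟨P', hP', hloc⟩ := hP
    obtain ⟨V₁, hV₁, -, hx₁, hV₁U, Q, hQ, hQS⟩ := hloc x₀ hx₀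
    obtain ⟨V, hV, hxV, hVV, hS⟩ := ih hQS hV₁ hx₁
    refine ⟨V, hV, hxV, hVV.trans hV₁U, fun {G} _ _ _ Λ => ?_⟩
    obtain ⟨Λ', hΛ'⟩ := LipMapZero.exists_push (F := F) Λ
    let A₀ : F →ₗ[ℝ] G := Λ.toLinearMap ∘ₗ (P' x₀).toLin
    have hA₀ : Continuous A₀ := Λ.continuous.comp (P' x₀).continuous
    let q₀ : CSem F := CSem.ofLinear A₀ hA₀
    obtain ⟨B₀, hB₀⟩ := exists_lift_of_bound q₀ A₀ (C := 1) fun x => by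
      rw [one_mul]
      exact le_rfl
    let ρ₀ : BS (q₀ ⊔ unitSem F) →L[ℝ] BS q₀ := res le_sup_left
    let ρ₁ : BS (q₀ ⊔ unitSem F) →L[ℝ] BS (unitSem F) := res le_sup_right
    refine ⟨Λ.continuous.comp_continuousOn (hP'.continuousOn.mono (hVV.trans hV₁U)),
      q₀ ⊔ unitSem F, fun x => B₀.comp ρ₀ + (Λ' (Q x)).comp ρ₁, ?_, ?_⟩
    · intro x hx h
      have h1 := (Λ.continuous.tendsto _).comp (hP'.tendsto x (hV₁U (hVV hx)) h)
      have e : (B₀.comp ρ₀ + (Λ' (Q x)).comp ρ₁) (iota (q₀ ⊔ unitSem F) h) = Λ (P' x h) := by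
        have e1 : P' x h = P' x₀ h + (Q x).toLipMap h := by
          rw [hQ x (hVV hx)]
          exact (add_sub_cancel (P' x₀ h) (P' x h)).symm
        rw [e1, map_add]
        simp only [_root_.add_apply, ContinuousLinearMap.comp_apply, ρ₀, ρ₁, res_iota, hB₀, hΛ']
        rfl
      rw [e]
      refine h1.congr fun t => ?_
      simp
    · refine (SC.const k V _).add ?_
      exact (hS Λ').clm
        ((ContinuousLinearMap.compL ℝ (BS (q₀ ⊔ unitSem F)) (BS (unitSem F)) G).flip ρ₁)

end Front

/-! ### The open mapping theorem and parametrices of Fredholm operators -/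

section OpenMapping

variable {E : Type*} [AddCommGroup E] [Module ℝ E] [MetricSpace E] [FrechetSpace E]
  {R : Type*} [AddCommGroup R] [Module ℝ R] [MetricSpace R] [FrechetSpace R]

/-- By Baire's theorem, the image of a ball under a surjective map is dense in a neighbourhood of
zero. -/
theorem exists_approx_preimage {T : E →L[ℝ] R} (hT : Function.Surjective T) {ε : ℝ} (hε : 0 < ε) :
    ∃ δ > 0, ∀ y, dist y 0 < δ → ∀ η > 0, ∃ x, dist x 0 < ε ∧ dist (y - T x) 0 < η := by
  let f : ℕ → Set R := fun n =>
    closure ((fun x => ((n + 1 : ℕ) : ℝ) • T x) '' Metric.ball (0 : E) (ε / 2))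
  have hcover : ⋃ n, f n = univ := by
    refine eq_univ_of_forall fun y => ?_
    obtain ⟨x, rfl⟩ := hT y
    have ht : Tendsto (fun n : ℕ => (1 / ((n : ℝ) + 1)) • x) atTop (𝓝 ((0 : ℝ) • x)) :=
      tendsto_one_div_add_atTop_nhds_zero_nat.smul_const x
    rw [zero_smul] at ht
    obtain ⟨n, hn⟩ := (ht.eventually (Metric.ball_mem_nhds 0 (half_pos hε))).exists
    refine mem_iUnion.2 ⟨n, subset_closure ⟨_, hn, ?_⟩⟩
    change ((n + 1 : ℕ) : ℝ) • T ((1 / ((n : ℝ) + 1)) • x) = T x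
    rw [map_smul, smul_smul]
    push_cast
    rw [mul_one_div_cancel (by positivity), one_smul]
  obtain ⟨n, z, hz⟩ := nonempty_interior_of_iUnion_of_closed (fun n => isClosed_closure) hcover
  obtain ⟨δ, hδ, hb⟩ := Metric.mem_nhds_iff.1 (mem_interior_iff_mem_nhds.1 hz)
  have hn : (0 : ℝ) < (n + 1 : ℕ) := by positivity
  refine ⟨δ / (n + 1 : ℕ), by positivity, fun y hy η hη => ?_⟩
  have h1 : z ∈ f n := hb (Metric.mem_ball_self hδ)
  have h2 : z + ((n + 1 : ℕ) : ℝ) • y ∈ f n := by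
    refine hb ?_
    rw [Metric.mem_ball, ← dist_sub_zero, add_sub_cancel_left]
    refine (dist_nsmul_zero_le _ _).trans_lt ?_
    rwa [lt_div_iff₀ hn, mul_comm] at hy
  obtain ⟨_, ⟨x₁, hx₁, rfl⟩, hd₁⟩ := Metric.mem_closure_iff.1 h1 (η / 2) (half_pos hη)
  obtain ⟨_, ⟨x₂, hx₂, rfl⟩, hd₂⟩ := Metric.mem_closure_iff.1 h2 (η / 2) (half_pos hη)
  rw [Metric.mem_ball] at hx₁ hx₂
  refine ⟨x₂ - x₁, ?_, ?_⟩
  · rw [sub_eq_add_neg]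
    refine (dist_add_zero_le _ _).trans_lt ?_
    rw [dist_neg_zero]
    linarith
  · have e : y - T (x₂ - x₁) = (((n + 1 : ℕ) : ℝ)⁻¹) •
        ((z + ((n + 1 : ℕ) : ℝ) • y - ((n + 1 : ℕ) : ℝ) • T x₂) +
          -(z - ((n + 1 : ℕ) : ℝ) • T x₁)) := by
      rw [eq_inv_smul_iff₀ hn.ne', map_sub]
      module
    rw [e]
    refine (dist_smul_zero_le ?_ _).trans_lt ((dist_add_zero_le _ _).trans_lt ?_)
    · rw [abs_of_pos (by positivity)]
      exact inv_le_one_of_one_le₀ (by exact_mod_cast Nat.succ_le_succ n.zero_le)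
    · rw [dist_neg_zero, dist_sub_zero, dist_sub_zero]
      linarith

/-- The open mapping theorem for Fréchet spaces: successive approximation removes the error in
`exists_approx_preimage`. -/
theorem exists_small_preimage {T : E →L[ℝ] R} (hT : Function.Surjective T) {ε : ℝ} (hε : 0 < ε) :
    ∃ δ > 0, ∀ y, dist y 0 < δ → ∃ x, dist x 0 < ε ∧ T x = y := by
  have hex : ∀ k : ℕ, ∃ δ > 0, ∀ y, dist y 0 < δ → ∀ η > 0,
      ∃ x, dist x 0 < ε / 2 / 2 / 2 ^ k ∧ dist (y - T x) 0 < η :=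
    fun k => exists_approx_preimage hT (by positivity)
  choose δ hδ h using hex
  let δ' : ℕ → ℝ := fun k => min (δ k) ((1 / 2) ^ k)
  have hδ' : ∀ k, 0 < δ' k := fun k => lt_min (hδ k) (by positivity)
  refine ⟨δ' 0, hδ' 0, fun y hy => ?_⟩
  have h' : ∀ (k : ℕ) (r : R), dist r 0 < δ' k →
      ∃ x, dist x 0 < ε / 2 / 2 / 2 ^ k ∧ dist (r - T x) 0 < δ' (k + 1) :=
    fun k r hr => h k r (hr.trans_le (min_le_left _ _)) _ (hδ' _)
  choose! g hg1 hg2 using h'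
  let s : ℕ → E := fun k => Nat.rec 0 (fun k x => x + g k (y - T x)) k
  have hs : ∀ k, s (k + 1) = s k + g k (y - T (s k)) := fun k => rfl
  have hinv : ∀ k, dist (y - T (s k)) 0 < δ' k := by
    intro k
    induction k with
    | zero => simpa [s] using hy
    | succ k ih =>
      rw [hs, map_add, ← sub_sub]
      exact hg2 k _ ih
  have hstep : ∀ k, dist (s k) (s (k + 1)) ≤ ε / 2 / 2 / 2 ^ k := fun k => by
    rw [dist_comm, ← dist_sub_zero, hs, add_sub_cancel_left]
    exact (hg1 k _ (hinv k)).le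
  obtain ⟨x, hx⟩ := cauchySeq_tendsto_of_complete (cauchySeq_of_le_geometric_two hstep)
  refine ⟨x, ?_, ?_⟩
  · have := dist_le_of_le_geometric_two_of_tendsto₀ hstep hx
    rw [dist_comm]
    exact this.trans_lt (half_lt_self hε)
  · have h1 : Tendsto (fun k => y - T (s k)) atTop (𝓝 (y - T x)) :=
      tendsto_const_nhds.sub ((T.continuous.tendsto x).comp hx)
    have h2 : Tendsto (fun k => y - T (s k)) atTop (𝓝 0) := by
      rw [tendsto_iff_dist_tendsto_zero]
      refine squeeze_zero (fun _ => dist_nonneg)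
        (fun k => (hinv k).le.trans (min_le_right _ _)) ?_
      exact tendsto_pow_atTop_nhds_zero_of_lt_one (by norm_num) (by norm_num)
    exact (sub_eq_zero.1 (tendsto_nhds_unique h1 h2)).symm

theorem FrechetSpace.of_isClosed {p : Submodule ℝ E} (hp : IsClosed (p : Set E)) :
    FrechetSpace p :=
  { toStandardMetric := StandardMetric.of_le
      (fun x y z => StandardMetric.dist_add_right' (x : E) y z)
      (fun _ x ha => dist_smul_zero_le ha (x : E))
      (fun _ _ x y ha hb hab => dist_convex_zero_le ha hb hab (x : E) y)
    toIsTopologicalAddGroup := inferInstance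
    toContinuousSMul := inferInstance
    toLocallyConvexSpace := LocallyConvexSpace.induced p.subtype
    toCompleteSpace := hp.completeSpace_coe }

/-- A Lipschitz-Fredholm operator is invertible modulo a continuous operator that factors through
a finite-dimensional space. -/
theorem IsLipschitzFredholm.exists_parametrix {L : LipMap E E} (hL : IsLipschitzFredholm L) :
    ∃ (n : ℕ) (s : (Fin n → ℝ) →L[ℝ] E) (π : E →L[ℝ] (Fin n → ℝ)) (A : E →L[ℝ] E),
      ∀ x, A (L x) = x - s (π x) := by
  have := hL.finite_ker
  have := hL.finite_coker
  have := FrechetSpace.of_isClosed hL.isClosed_range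
  let R : Submodule ℝ E := LinearMap.range L.toLin
  let T : E →L[ℝ] R := ⟨L.toLin.rangeRestrict, L.continuous.subtype_mk _⟩
  have hT : Function.Surjective T := L.toLin.surjective_rangeRestrict
  obtain ⟨ρ, hρ⟩ := Submodule.ClosedComplemented.of_finiteDimensional_quotient (p := R)
    hL.isClosed_range
  obtain ⟨P, hP⟩ := Submodule.ClosedComplemented.of_finiteDimensional (LinearMap.ker L.toLin)
  let Θ : LinearMap.ker L.toLin ≃L[ℝ] (Fin (Module.finrank ℝ (LinearMap.ker L.toLin)) → ℝ) :=
    ContinuousLinearEquiv.ofFinrankEq (by simp)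
  -- The operator `1 - P` vanishes on the kernel, so that it factors through `T`.
  have hker : ∀ x x' : E, T x = T x' → x - (P x : E) = x' - (P x' : E) := fun x x' h => by
    have h1 : L x = L x' := congrArg Subtype.val h
    have h2 : x - x' ∈ LinearMap.ker L.toLin := by
      rw [LinearMap.mem_ker, map_sub]
      exact sub_eq_zero.2 h1
    have h3 : ((P (x - x') : LinearMap.ker L.toLin) : E) = x - x' :=
      congrArg Subtype.val (hP ⟨x - x', h2⟩)
    rw [map_sub, Submodule.coe_sub] at h3
    rw [sub_eq_sub_iff_sub_eq_sub, h3]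
  choose g hg using hT
  let A₀ : R →ₗ[ℝ] E :=
    { toFun := fun y => g y - (P (g y) : E)
      map_add' := fun y y' => by
        rw [hker (g (y + y')) (g y + g y') (by rw [map_add, hg, hg, hg]), map_add,
          Submodule.coe_add]
        abel
      map_smul' := fun a y => by
        rw [hker (g (a • y)) (a • g y) (by rw [map_smul, hg, hg]), map_smul, Submodule.coe_smul,
          RingHom.id_apply, smul_sub] }
  have hA₀ : ∀ x, A₀ (T x) = x - (P x : E) := fun x => hker _ _ (hg _)
  have hcont : Continuous A₀ := by
    refine continuous_of_standard A₀ fun ε hε => ?_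
    have hc : Continuous fun x : E => x - (P x : E) := by fun_prop
    obtain ⟨δ, hδ, h⟩ := Metric.continuousAt_iff.1 (hc.continuousAt (x := 0)) ε hε
    obtain ⟨δ', hδ', h'⟩ := exists_small_preimage (T := T) (fun y => ⟨g y, hg y⟩) hδ
    refine ⟨δ', hδ', fun y hy => ?_⟩
    obtain ⟨x, hx, rfl⟩ := h' y hy
    rw [hA₀]
    have := h hx
    simp only [map_zero, Submodule.coe_zero, sub_zero] at this
    exact this.le
  refine ⟨_, (LinearMap.ker L.toLin).subtypeL.comp Θ.symm.toContinuousLinearMap,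
    Θ.toContinuousLinearMap.comp P, (⟨A₀, hcont⟩ : R →L[ℝ] E).comp ρ, fun x => ?_⟩
  have h1 : ρ (L x) = T x := hρ (T x)
  change A₀ (ρ (L x)) = x - ((Θ.symm (Θ (P x)) : LinearMap.ker L.toLin) : E)
  rw [h1, hA₀, ContinuousLinearEquiv.symm_apply_apply]

end OpenMapping

/-! ### Reduction of a vector field near a zero -/

section LocalSard

open MeasureTheory

variable {F : Type u} [AddCommGroup F] [Module ℝ F] [MetricSpace F] [FrechetSpace F]
  {H : Type u} [AddCommGroup H] [Module ℝ H] [MetricSpace H] [StandardMetric H]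

theorem IsReduction.mono {N : Type} [NormedAddCommGroup N] [NormedSpace ℝ N] {K : ℕ} {V W : Set F}
    {q : CSem F} {s : N →L[ℝ] F} {π : BS q →L[ℝ] N} {R : F → BS q →L[ℝ] F} {σ : F → F}
    (hW : W ⊆ V) (h : IsReduction K V q s π R σ) : IsReduction K W q s π R σ :=
  ⟨h.continuousOn.mono hW, fun x hx => h.deriv x (hW hx), fun r => (h.smooth r).mono hW,
    fun x hx => h.isUnit x (hW hx)⟩

/-- If the derivative of the smooth map `T ∘ Y` at `x₀` is a Lipschitz-Fredholm operator, then a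
parametrix turns the equation `T ∘ Y = 0` near `x₀` into one whose derivative is a small
perturbation of the identity, modulo operators of finite rank. -/
theorem exists_isReduction {U : Set F} {Y : F → H} (K : ℕ)
    (hY : MC.{u, u} (K + 1) U Y) {x₀ : F} (hx₀ : x₀ ∈ U) (T : H →L[ℝ] F) {L : LipMap F F}
    {n : ℕ} {s : (Fin n → ℝ) →L[ℝ] F} {π : F →L[ℝ] (Fin n → ℝ)} {A : F →L[ℝ] F}
    (hA : ∀ x, A (L x) = x - s (π x))
    (hTL : ∀ h, Tendsto (fun t : ℝ => t⁻¹ • (T (Y (x₀ + t • h)) - T (Y x₀))) (𝓝[≠] 0) (𝓝 (L h))) :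
    ∃ (q : CSem F) (π' : BS q →L[ℝ] (Fin n → ℝ)) (R : F → BS q →L[ℝ] F) (σ : F → F) (V : Set F),
      IsOpen V ∧ x₀ ∈ V ∧ IsReduction K V q s π' R σ ∧ ∀ x, T (Y x) = 0 → σ x = 0 := by
  obtain ⟨P', hP', hloc⟩ := hY
  obtain ⟨V₁, hV₁, -, hx₁, hV₁U, Q, hQ, hQS⟩ := hloc x₀ hx₀
  obtain ⟨V, hV, hxV, hVV, hS⟩ := MC.exists_SC hQS hV₁ hx₁
  have hslope : ∀ x ∈ U, ∀ h, Tendsto (fun t : ℝ => t⁻¹ • (T (Y (x + t • h)) - T (Y x))) (𝓝[≠] 0)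
      (𝓝 (T (P' x h))) := fun x hx h => by
    refine ((T.continuous.tendsto _).comp (hP'.tendsto x hx h)).congr fun t => ?_
    simp
  have hP0 : ∀ h, T (P' x₀ h) = L h := fun h => tendsto_nhds_unique (hslope x₀ hx₀ h) (hTL h)
  have hPQ : ∀ x ∈ V, ∀ h, P' x h = P' x₀ h + (Q x).toLipMap h := fun x hx h => by
    rw [hQ x (hVV hx)]
    exact (add_sub_cancel (P' x₀ h) (P' x h)).symm
  let q₀ : CSem F := CSem.ofLinear π.toLinearMap π.continuous
  let q : CSem F := q₀ ⊔ unitSem F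
  obtain ⟨π', hπ'⟩ := exists_lift_of_bound q π.toLinearMap (C := 1) fun x => by
    rw [one_mul]
    exact (le_sup_left : q₀ ≤ q) x
  let ρ : BS q →L[ℝ] BS (unitSem F) := res le_sup_right
  -- The seminorm `unitSem F` bounds `A T (Q x)` into every seminorm of `F`, so that this operator
  -- extends to the completion as a map with values in `F` itself.
  have hex : ∀ x, ∃ B : BS q →L[ℝ] F, ∀ h, B (iota q h) = A (T ((Q x).toLipMap h)) := fun x => by
    refine exists_lift q (A.toLinearMap ∘ₗ T.toLinearMap ∘ₗ (Q x).toLipMap.toLin) fun W hW => ?_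
    obtain ⟨r, hr⟩ := CSem.exists_ball_subset hW
    obtain ⟨C, hC⟩ := LipMapZero.exists_bound ((iota r).comp (A.comp T)) (Q x)
    refine ⟨1 / (|C| + 1), by positivity, fun h hh => hr _ ?_⟩
    rw [sub_zero, ← norm_iota]
    refine (hC h).trans_lt ?_
    rw [lt_div_iff₀ (by positivity)] at hh
    have h1 : unitSem F h ≤ q h := (le_sup_right : unitSem F ≤ q) h
    have h2 := (unitSem F).nonneg h
    have h3 := le_abs_self C
    have h4 := abs_nonneg C
    nlinarith
  choose R hR using hex
  have hRS : ∀ r : CSem F, SC K V fun x => (iota r).comp (R x) := fun r => by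
    obtain ⟨Λ', hΛ'⟩ := LipMapZero.exists_push (F := F) ((iota r).comp (A.comp T))
    refine ((hS Λ').clm ((ContinuousLinearMap.compL ℝ (BS q) (BS (unitSem F)) (BS r)).flip
      ρ)).congr hV fun x _ => ext_iota fun h => ?_
    change Λ' (Q x) (ρ (iota q h)) = iota r (R x (iota q h))
    rw [hR, res_iota, hΛ']
    rfl
  have hcont : ContinuousOn (fun x => 1 + (iota q).comp (R x)) V :=
    continuousOn_const.add (hRS q).continuousOn
  refine ⟨q, π', R, fun x => A (T (Y x)),
    V ∩ (fun x => 1 + (iota q).comp (R x)) ⁻¹' {L | IsUnit L},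
    hcont.isOpen_inter_preimage hV Units.isOpen, ⟨hxV, ?_⟩,
    ⟨?_, ?_, fun r => (hRS r).mono inter_subset_left, fun x hx => hx.2⟩, ?_⟩
  · have h0 : (iota q).comp (R x₀) = 0 := ext_iota fun h => by
      have h1 : (Q x₀).toLipMap h = 0 := by
        rw [hQ x₀ hx₁, sub_self]
        rfl
      rw [ContinuousLinearMap.comp_apply, hR, h1, map_zero, map_zero, map_zero]
      rfl
    change IsUnit (1 + (iota q).comp (R x₀))
    rw [h0, add_zero]
    exact isUnit_one
  · exact (A.continuous.comp T.continuous).comp_continuousOn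
      (hP'.continuousOn.mono (inter_subset_left.trans (hVV.trans hV₁U)))
  · rintro x ⟨hx, -⟩ h
    have e : h + R x (iota q h) - s (π' (iota q h)) = A (T (P' x h)) := by
      have e1 : π' (iota q h) = π h := hπ' h
      rw [hPQ x hx, map_add, map_add, hP0, hA, hR, e1]
      abel
    rw [e]
    refine ((A.continuous.tendsto _).comp (hslope x (hV₁U (hVV hx)) h)).congr fun t => ?_
    simp
  · intro x hx
    simp [hx]

/-- The local form of the theorem: near each point, the critical points of `f` that are zeros of
a map with Lipschitz-Fredholm derivative at this point have a null set of values. -/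
theorem exists_volume_image_critical_eq_zero [SecondCountableTopology F] {U : Set F}
    (hU : IsOpen U) {Y : F → H} (hY : MCInfty.{u, u} U Y) {x₀ : F} (hx₀ : x₀ ∈ U) (T : H →L[ℝ] F)
    {L : LipMap F F} (hL : IsLipschitzFredholm L)
    (hTL : ∀ h, Tendsto (fun t : ℝ => t⁻¹ • (T (Y (x₀ + t • h)) - T (Y x₀))) (𝓝[≠] 0) (𝓝 (L h)))
    {f : F → ULift.{u} ℝ} (hf : MCInfty.{u, u} U f) :
    ∃ O ∈ 𝓝 x₀,
      volume ((fun x => (f x).down) '' {x ∈ O | T (Y x) = 0 ∧ IsDirCritical f x}) = 0 := by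
  obtain ⟨n, s, π, A, hA⟩ := hL.exists_parametrix
  obtain ⟨q, π', R, σ, V, hV, hxV, hred, hσ⟩ :=
    exists_isReduction ((n + 2) ^ 2) (hY _) hx₀ T hA hTL
  obtain ⟨W, hW, hxW, -, hS⟩ := MC.exists_SC (hf ((n + 2) ^ 2)) hU hx₀
  have hfS : SC ((n + 2) ^ 2) W f := hS (ContinuousLinearMap.id ℝ (ULift.{u} ℝ))
  obtain ⟨O, hO, hO'⟩ := IsReduction.sard n (by simp) le_rfl (hV.inter hW)
    (hred.mono inter_subset_left) (hfS.mono inter_subset_right) ⟨hxV, hxW⟩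
  refine ⟨O, hO, measure_mono_null (image_mono ?_) hO'⟩
  rintro x ⟨hx, hTx, hc⟩
  exact ⟨hx, hσ x hTx, hc⟩

/-- The chain rule at a critical point. -/
theorem IsDirCritical.comp {G : Type u} [NormedAddCommGroup G] [NormedSpace ℝ G] {V : Set F}
    (hV : IsOpen V) {g : F → G} (hg : SC 1 V g) {φ : F → F} {x k h : F} (hx : φ x ∈ V)
    (hc : IsDirCritical g (φ x))
    (hφ : Tendsto (fun t : ℝ => t⁻¹ • (φ (x + t • k) - φ x)) (𝓝[≠] 0) (𝓝 h)) :
    Tendsto (fun t : ℝ => t⁻¹ • (g (φ (x + t • k)) - g (φ x))) (𝓝[≠] 0) (𝓝 0) := by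
  obtain ⟨-, q, B, hB, hBS⟩ := hg
  -- Strict differentiability of `g` with derivative zero makes the increments of `g` negligible.
  have hB0 : B (φ x) = 0 := ext_iota fun v => tendsto_nhds_unique (hB _ hx v) (hc v)
  have hφc : Tendsto (fun t : ℝ => φ (x + t • k)) (𝓝[≠] 0) (𝓝 (φ x)) := by
    have h1 : Tendsto (fun t : ℝ => t) (𝓝[≠] 0) (𝓝 0) := nhdsWithin_le_nhds
    have h2 := (h1.smul hφ).const_add (φ x)
    rw [zero_smul, add_zero] at h2
    refine h2.congr' ?_
    filter_upwards [self_mem_nhdsWithin] with t ht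
    rw [smul_inv_smul₀ ht, add_sub_cancel]
  rw [Metric.tendsto_nhds]
  intro ε hε
  have hq := q.nonneg h
  obtain ⟨r, hr, -, H⟩ := hB.strict hV hBS hx (ε := ε / (q h + 1)) (by positivity)
  have h1 : ∀ᶠ t in 𝓝[≠] (0 : ℝ), q (t⁻¹ • (φ (x + t • k) - φ x)) < q h + 1 :=
    ((q.continuous.tendsto h).comp hφ).eventually (gt_mem_nhds (by linarith))
  filter_upwards [h1, hφc.eventually (Metric.ball_mem_nhds _ hr)] with t ht ht'
  have h2 := H _ (Metric.mem_ball_self hr) _ ht'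
  rw [hB0, _root_.zero_apply, sub_zero] at h2
  rw [CSem.smul] at ht
  rw [dist_zero_right, norm_smul, Real.norm_eq_abs]
  calc |t⁻¹| * ‖g (φ (x + t • k)) - g (φ x)‖
      ≤ |t⁻¹| * (ε / (q h + 1) * q (φ (x + t • k) - φ x)) := by gcongr
    _ = ε / (q h + 1) * (|t⁻¹| * q (φ (x + t • k) - φ x)) := by ring
    _ < ε / (q h + 1) * (q h + 1) := by gcongr
    _ = ε := div_mul_cancel₀ _ (by positivity)

end LocalSard

/-! ### Critical points of functionals on manifolds -/

section ManifoldSard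

open MeasureTheory

theorem dirDeriv_eq {E : Type*} {H : Type*} [AddCommGroup E] [Module ℝ E] [AddCommGroup H]
    [Module ℝ H] [MetricSpace H] {P : E → H} {x h : E} {y : H}
    (hP : Tendsto (fun t : ℝ => t⁻¹ • (P (x + t • h) - P x)) (𝓝[≠] 0) (𝓝 y)) :
    dirDeriv P x h = y :=
  hP.limUnder_eq

theorem dirDeriv_zero {E : Type*} {H : Type*} [AddCommGroup E] [Module ℝ E] [AddCommGroup H]
    [Module ℝ H] [MetricSpace H] (P : E → H) (x : E) : dirDeriv P x 0 = 0 :=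
  dirDeriv_eq (by simp)

theorem eventuallyEq_chart_symm_id {X Y : Type*} [TopologicalSpace X] [TopologicalSpace Y]
    (e : OpenPartialHomeomorph X Y) {x : Y} (hx : x ∈ e.target) :
    e ∘ e.symm =ᶠ[𝓝 x] id := by
  filter_upwards [e.open_target.mem_nhds hx] with y hy
  exact e.right_inv hy

theorem dirDeriv_of_eventuallyEq_id {E : Type*} [AddCommGroup E] [Module ℝ E] [MetricSpace E]
    [ContinuousAdd E] [ContinuousSMul ℝ E] {P : E → E} {x : E} (h : P =ᶠ[𝓝 x] id) (k : E) :
    dirDeriv P x k = k := by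
  refine dirDeriv_eq (tendsto_const_nhds.congr' ?_)
  have hc : Tendsto (fun t : ℝ => x + t • k) (𝓝[≠] 0) (𝓝 x) := by
    have : Continuous fun t : ℝ => x + t • k := by fun_prop
    refine (this.tendsto' 0 x (by simp)).mono_left nhdsWithin_le_nhds
  filter_upwards [hc.eventually h, self_mem_nhdsWithin] with t ht ht0
  rw [ht, h.eq_of_nhds, id, id, add_sub_cancel_left, inv_smul_smul₀ ht0]

theorem tangentMap_of_eventuallyEq_id {E : Type*} [AddCommGroup E] [Module ℝ E] [MetricSpace E]
    [ContinuousAdd E] [ContinuousSMul ℝ E] {P : E → E} {x : E} (h : P =ᶠ[𝓝 x] id) (k : E) :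
    tangentMap P (x, k) = (x, k) :=
  Prod.ext h.eq_of_nhds (dirDeriv_of_eventuallyEq_id h k)

variable {F : Type u} [AddCommGroup F] [Module ℝ F] [MetricSpace F] [FrechetSpace F]
  {M : Type v} [TopologicalSpace M] [ChartedSpace F M]

theorem Tan.coord_chartAt (p : M) (f : F) :
    (⟨p, f⟩ : Tan F M).coord (chartAt F p) = (chartAt F p p, f) :=
  tangentMap_of_eventuallyEq_id
    (eventuallyEq_chart_symm_id _ ((chartAt F p).map_source (mem_chart_source F p))) f

theorem TanTan.coord_chartAt (p : M) (f : F) (w : F × F) :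
    (⟨⟨p, f⟩, w⟩ : TanTan F M).coord (chartAt F p) = ((chartAt F p p, f), w) := by
  refine tangentMap_of_eventuallyEq_id ?_ w
  have hp := (chartAt F p).map_source (mem_chart_source F p)
  filter_upwards [((chartAt F p).open_target.prod isOpen_univ).mem_nhds
    (show (chartAt F p p, f) ∈ (chartAt F p).target ×ˢ univ from ⟨hp, trivial⟩)] with z hz
  exact tangentMap_of_eventuallyEq_id (eventuallyEq_chart_symm_id _ hz.1) z.2

/-- At a zero the covariant derivative does not depend on the connection: it is the derivative of
the principal part of the vector field. -/
theorem covDeriv_eq_of_zero {K : TanTan F M → Tan F M} (hK : IsLinearConnection K)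
    {ξ : M → Tan F M} {p : M} (hp : ξ p = ⟨p, 0⟩) {h k : F} (hk : covDeriv K ξ ⟨p, h⟩ = ⟨p, k⟩) :
    (dirDeriv (fun x => (ξ ((chartAt F p).symm x)).coord (chartAt F p)) (chartAt F p p) h).2 =
      k := by
  obtain ⟨τ, -, -, hlin, hτ⟩ := hK.local_form (chartAt F p) (chart_mem_atlas F p)
  set w := dirDeriv (fun x => (ξ ((chartAt F p).symm x)).coord (chartAt F p)) (chartAt F p p) h
    with hw
  have hW : tangentMapField ξ ⟨p, h⟩ = ⟨⟨p, 0⟩, w⟩ := by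
    rw [tangentMapField, hp]
  have h1 := hτ ⟨⟨p, 0⟩, w⟩ (mem_chart_source F p)
  rw [covDeriv, hW] at hk
  rw [hk, Tan.coord_chartAt, TanTan.coord_chartAt] at h1
  have h2 := congrArg Prod.snd h1
  -- The connection term is linear in the value of the field, and this value is zero.
  have h3 : τ (chartAt F p p, 0) = 0 :=
    (hlin _ ((chartAt F p).map_source (mem_chart_source F p))).map_zero
  simp only [localForm, h3] at h2
  rw [h2]
  exact (add_zero w.2).symm

/-- Critical points are defined through the preferred chart at the point; their coordinates in every
chart are critical points of the local representative. -/
theorem isDirCritical_of_isCriticalPoint [BoundedFrechetManifold F M] {l : M → ℝ}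
    (hl : IsMCInftyFunctional F l) {e : OpenPartialHomeomorph M F} (he : e ∈ atlas F M) {x : F}
    (hx : x ∈ e.target) (hc : IsCriticalPoint F l (e.symm x)) :
    IsDirCritical (fun x => ULift.up.{u} (l (e.symm x))) x := by
  intro k
  let c := chartAt F (e.symm x)
  have hxs : e.symm x ∈ c.source := mem_chart_source F _
  have hct : c (e.symm x) ∈ c.target := c.map_source hxs
  have hxt : x ∈ (e.symm.trans c).source := by
    rw [OpenPartialHomeomorph.trans_source]
    exact ⟨hx, hxs⟩
  let g : F → ULift.{u} ℝ := fun y => ULift.up (l (c.symm y))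
  have hg : MCInfty.{u, u} c.target g := hl c (chart_mem_atlas F _)
  obtain ⟨V, hV, hxV, -, hS⟩ := MC.exists_SC (hg 1) c.open_target hct
  have hgS : SC 1 V g := hS (ContinuousLinearMap.id ℝ (ULift.{u} ℝ))
  obtain ⟨φ', hφ', -⟩ := BoundedFrechetManifold.transition e he c (chart_mem_atlas F _) 1
  obtain ⟨g', hg', -⟩ := hg 1
  have hgc : IsDirCritical g (c (e.symm x)) := fun h => by
    have h1 := hg'.tendsto _ hct h
    have h2 : (g' (c (e.symm x)) h).down = 0 := by
      have h2 : Tendsto (fun t : ℝ => t⁻¹ • ((l ∘ c.symm) (c (e.symm x) + t • h) -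
          (l ∘ c.symm) (c (e.symm x)))) (𝓝[≠] 0) (𝓝 (g' (c (e.symm x)) h).down) :=
        (continuous_uliftDown.tendsto _).comp h1
      rw [← hc h, dirDeriv_eq h2]
    have h3 : g' (c (e.symm x)) h = 0 := ULift.ext _ _ h2
    rwa [h3] at h1
  have h4 := hgc.comp hV hgS (φ := c ∘ e.symm) hxV (hφ'.tendsto x hxt k)
  refine h4.congr' ?_
  have hev : ∀ᶠ t in 𝓝[≠] (0 : ℝ), x + t • k ∈ (e.symm.trans c).source :=
    nhdsWithin_le_nhds (eventually_line_mem (e.symm.trans c).open_source hxt k)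
  filter_upwards [hev] with t ht
  rw [OpenPartialHomeomorph.trans_source] at ht
  simp only [g, Function.comp_apply]
  rw [c.left_inv hxs, c.left_inv ht.2]

/-- The model space is the union of the multiples of a translate of a chart domain. -/
theorem secondCountableTopology_model [SecondCountableTopology M] [Nonempty M] :
    SecondCountableTopology F := by
  obtain ⟨p⟩ := ‹Nonempty M›
  let e := chartAt F p
  have h1 : SecondCountableTopology e.target :=
    e.toHomeomorphSourceTarget.symm.isEmbedding.secondCountableTopology
  have h2 : TopologicalSpace.IsSeparable e.target := by
    have := TopologicalSpace.isSeparable_range (f := ((↑) : e.target → F)) continuous_subtype_val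
    rwa [Subtype.range_coe] at this
  have h3 : TopologicalSpace.IsSeparable
      (⋃ n : ℕ, (fun x => (n : ℝ) • (x - e p)) '' e.target) :=
    .iUnion fun n => h2.image (by fun_prop)
  have h4 : ⋃ n : ℕ, (fun x => (n : ℝ) • (x - e p)) '' e.target = univ := by
    refine eq_univ_of_forall fun y => ?_
    have ht : Tendsto (fun n : ℕ => e p + (n : ℝ)⁻¹ • y) atTop (𝓝 (e p + (0 : ℝ) • y)) :=
      (tendsto_inv_atTop_nhds_zero_nat.smul_const y).const_add _
    rw [zero_smul, add_zero] at ht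
    have hev := ht.eventually (e.open_target.mem_nhds (e.map_source (mem_chart_source F p)))
    obtain ⟨n, hn, hn0⟩ := (hev.and (eventually_gt_atTop 0)).exists
    refine mem_iUnion.2 ⟨n, _, hn, ?_⟩
    change (n : ℝ) • (e p + (n : ℝ)⁻¹ • y - e p) = y
    rw [add_sub_cancel_left, smul_inv_smul₀ (by positivity)]
  rw [h4, TopologicalSpace.isSeparable_univ_iff] at h3
  exact UniformSpace.secondCountable_of_separable F

/-- The critical values of `l` form, locally on the manifold, a null set. -/
theorem exists_nhds_volume_image_critSet_eq_zero [BoundedFrechetManifold F M]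
    {K : TanTan F M → Tan F M} (hK : IsLinearConnection K)
    {ξ : M → Tan F M} (hξ : IsSmoothVectorField ξ) (hFred : IsLipschitzFredholmField K ξ)
    {l : M → ℝ} (hl : IsMCInftyFunctional F l) (hassoc : IsAssociated l ξ)
    {p : M} (hp : p ∈ critSet F l) : ∃ O ∈ 𝓝 p, volume (l '' (O ∩ critSet F l)) = 0 := by
  have : Nonempty M := ⟨p⟩
  have := secondCountableTopology_model (F := F) (M := M)
  let e := chartAt F p
  have hps : p ∈ e.source := mem_chart_source F p
  have hpt : e p ∈ e.target := e.map_source hps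
  have hzero : ∀ p, p ∈ critSet F l → ξ p = ⟨p, 0⟩ := fun p hp => by
    have h1 := hξ.base_eq p
    have h2 := (hassoc p).1 hp
    rcases h : ξ p with ⟨b, f⟩
    rw [h] at h1 h2
    simp only at h1 h2
    rw [h1, h2]
  let Y : F → F × F := fun x => (ξ (e.symm x)).coord e
  have hY : MCInfty.{u, u} e.target Y := hξ.smooth e (chart_mem_atlas F p)
  obtain ⟨Y', hY', -⟩ := hY 1
  obtain ⟨L, hLK, hL⟩ := hFred p
  have hTL : ∀ h, Tendsto (fun t : ℝ => t⁻¹ • (ContinuousLinearMap.snd ℝ F F (Y (e p + t • h)) -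
      ContinuousLinearMap.snd ℝ F F (Y (e p)))) (𝓝[≠] 0) (𝓝 (L h)) := fun h => by
    have h1 := hY'.tendsto _ hpt h
    have h2 : (Y' (e p) h).2 = L h := by
      rw [← covDeriv_eq_of_zero hK (hzero p hp) (hLK h)]
      exact congrArg Prod.snd (dirDeriv_eq h1).symm
    rw [← h2]
    exact (continuous_snd.tendsto _).comp h1
  obtain ⟨O, hO, hO'⟩ := exists_volume_image_critical_eq_zero e.open_target hY hpt
    (ContinuousLinearMap.snd ℝ F F) hL hTL (hl e (chart_mem_atlas F p))
  refine ⟨e.source ∩ e ⁻¹' O,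
    inter_mem (e.open_source.mem_nhds hps) ((e.continuousAt hps).preimage_mem_nhds hO),
    measure_mono_null ?_ hO'⟩
  rintro _ ⟨p', ⟨⟨hs, hO₁⟩, hc⟩, rfl⟩
  have hinv : e.symm (e p') = p' := e.left_inv hs
  refine ⟨e p', ⟨hO₁, ?_, ?_⟩, ?_⟩
  -- The coordinates of a zero tangent vector have a vanishing second component in every chart.
  · change (Y (e p')).2 = 0
    simp only [Y]
    rw [hinv, hzero p' hc]
    exact dirDeriv_zero _ _
  · refine isDirCritical_of_isCriticalPoint hl (chart_mem_atlas F p) (e.map_source hs) ?_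
    rwa [hinv]
  · exact congrArg l hinv

/-- The Finsler metric is at most `∑ 2⁻ⁿ = 1`, so that every subset is bounded. -/
theorem isFinslerBounded_univ (N : ℕ → Tan F M → ℝ) : IsFinslerBounded N (univ : Set M) := by
  refine lt_of_le_of_lt (iSup₂_le fun a _ => iSup₂_le fun b _ => ?_) ENNReal.one_lt_top
  calc finslerDist N a b ≤ ∑' n : ℕ, ((2 : ℝ≥0∞) ^ (n + 1))⁻¹ :=
        ENNReal.tsum_le_tsum fun n => mul_le_of_le_one_right' tsub_le_self
    _ = 1 := by
        simp_rw [ENNReal.inv_pow]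
        rw [ENNReal.tsum_geometric_add_one, ENNReal.one_sub_inv_two, inv_inv,
          ENNReal.inv_mul_cancel (by simp) (by simp)]

theorem continuous_of_isMCInftyFunctional {l : M → ℝ} (hl : IsMCInftyFunctional F l) :
    Continuous l := by
  refine continuous_iff_continuousAt.2 fun p => ?_
  let e := chartAt F p
  have hps : p ∈ e.source := mem_chart_source F p
  have h1 : ContinuousOn (fun x => ULift.up.{u} (l (e.symm x))) e.target :=
    hl e (chart_mem_atlas F p) 0
  have h2 : ContinuousAt (fun x => l (e.symm x)) (e p) :=
    continuous_uliftDown.continuousAt.comp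
      (h1.continuousAt (e.open_target.mem_nhds (e.map_source hps)))
  refine (h2.comp (e.continuousAt hps)).congr ?_
  filter_upwards [e.open_source.mem_nhds hps] with p' hp'
  exact congrArg l (e.left_inv hp')

end ManifoldSard

end

end BoundedFrechet

theorem mainTheorem1
    {F : Type*} [AddCommGroup F] [Module ℝ F] [MetricSpace F] [BoundedFrechet.FrechetSpace F]
    {M : Type*} [TopologicalSpace M] [ChartedSpace F M]
    [BoundedFrechet.BoundedFrechetManifold F M] [ConnectedSpace M]
    (N : ℕ → BoundedFrechet.Tan F M → ℝ) (hN : BoundedFrechet.IsFinsler N)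
    (K : BoundedFrechet.TanTan F M → BoundedFrechet.Tan F M)
    (hK : BoundedFrechet.IsLinearConnection K)
    (ξ : M → BoundedFrechet.Tan F M) (hξ : BoundedFrechet.IsSmoothVectorField ξ)
    (hFred : BoundedFrechet.IsLipschitzFredholmField K ξ)
    (hWCV : BoundedFrechet.ConditionWCV N ξ)
    (l : M → ℝ) (hl : BoundedFrechet.IsMCInftyFunctional F l)
    (hassoc : BoundedFrechet.IsAssociated l ξ) :
    IsMeagre (l '' BoundedFrechet.critSet F l) ∧
      BoundedFrechet.regularValues F l ∈ residual ℝ := by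
  suffices h : IsMeagre (l '' BoundedFrechet.critSet F l) from ⟨h, h⟩
  have hcomp : IsCompact (BoundedFrechet.critSet F l) := by
    convert hWCV univ isClosed_univ (BoundedFrechet.isFinslerBounded_univ N) using 1
    ext p
    exact (hassoc p).trans (by simp)
  have hclosed : IsClosed (l '' BoundedFrechet.critSet F l) :=
    (hcomp.image (BoundedFrechet.continuous_of_isMCInftyFunctional hl)).isClosed
  have hnull : MeasureTheory.volume (l '' BoundedFrechet.critSet F l) = 0 :=
    BoundedFrechet.volume_image_eq_zero_of_locally fun p hp =>
      BoundedFrechet.exists_nhds_volume_image_critSet_eq_zero hK hξ hFred hl hassoc hp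
  have hint : interior (l '' BoundedFrechet.critSet F l) = ∅ :=
    MeasureTheory.Measure.interior_eq_empty_of_null hnull
  exact (hclosed.isNowhereDense_iff.2 hint).isMeagre
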